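/- For each integer $N\ge1$ let $(E_\sigma)_{\sigma\in\{-1,1\}^N}$ be independent centred Gaussian random variables of variance $N/2$ (the random energy model), write $\sigma^1\cdot\sigma^2=\sum_{j=1}^N\sigma^1_j\sigma^2_j$, and for $\beta>0$, $\lambda\in\mathbb{R}$ let $$Z_N^{(2)}(\beta,\lambda)=\sum_{\sigma^1,\sigma^2\in\{-1,1\}^N}\exp\bigl(-\beta(E_{\sigma^1}+E_{\sigma^2}-\lambda\,\sigma^1\cdot\sigma^2)\bigr),\qquad f^{(2)}(\beta,\lambda)=-\lim_{N\to\infty}\frac{1}{\beta N}\,\mathbb{E}\log Z_N^{(2)}(\beta,\lambda).$$ Let $\beta_c=2\sqrt{\log 2}$ and $\beta\ge\beta_c$. Then $\log Z_N^{(2)}(\beta,\lambda)$ is integrable for all $N$ and $\lambda$, the limit $f^{(2)}(\beta,\lambda)$ exists for every $\lambda\in\mathbb{R}$, and $\lambda\mapsto f^{(2)}(\beta,\lambda)$ is concave on $\mathbb{R}$ and differentiable outside a countable set. With $\lambda\downarrow0$ and $\lambda\uparrow0$ taken along points of differentiability, the limits of $\frac{\partial}{\partial\lambda}f^{(2)}(\beta,\lambda)$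 exist and equal, respectively, the right and the left derivative of $f^{(2)}(\beta,\cdot)$ at $0$, and they satisfy $$-\lim_{\lambda\downarrow0}\frac{\partial}{\partial\lambda}f^{(2)}(\beta,\lambda)=1,\qquad -\lim_{\lambda\uparrow0}\frac{\partial}{\partial\lambda}f^{(2)}(\beta,\lambda)\le1-\frac{\beta_c}{\beta}.$$ Consequently $f^{(2)}(\beta,\cdot)$ is not differentiable at $\lambda=0$, and $$q_{\rm jump}=\frac12\Bigl\{-\lim_{\lambda\downarrow0}\frac{\partial}{\partial\lambda}f^{(2)}(\beta,\lambda)+\lim_{\lambda\uparrow0}\frac{\partial}{\partial\lambda}f^{(2)}(\beta,\lambda)\Bigr\}>0.$$ -/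

import Mathlib

open MeasureTheory ProbabilityTheory Filter Topology

namespace REM

noncomputable section

/-- Spin configurations `σ = (σ₁, …, σ_N)` with `σ_j = ±1`. -/
abbrev Config (N : ℕ) : Type := Fin N → ℤˣ

/-- The law of the random energies `(E_σ)_σ`: independent centred Gaussians of variance `N / 2`,
one for each configuration. -/
def disorder (N : ℕ) : Measure (Config N → ℝ) :=
  Measure.pi fun _ => gaussianReal 0 ((N : NNReal) / 2)

/-- `σ¹ · σ² = ∑ⱼ σ¹ⱼ σ²ⱼ`. -/
def dot {N : ℕ} (s t : Config N) : ℝ :=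
  ∑ j, ((s j : ℤ) : ℝ) * ((t j : ℤ) : ℝ)

/-- The two-replica Hamiltonian `E_{σ¹} + E_{σ²} - lam σ¹ · σ²`. -/
def hamiltonian2 {N : ℕ} (E : Config N → ℝ) (lam : ℝ) (s t : Config N) : ℝ :=
  E s + E t - lam * dot s t

/-- The two-replica partition function. -/
def partition2 {N : ℕ} (E : Config N → ℝ) (β lam : ℝ) : ℝ :=
  ∑ s : Config N, ∑ t : Config N, Real.exp (-β * hamiltonian2 E lam s t)

/-- The averaged two-replica free energy per spin at finite `N`. -/
def freeEnergy2N (N : ℕ) (β lam : ℝ) : ℝ :=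
  -(1 / (β * N)) * ∫ E, Real.log (partition2 E β lam) ∂(disorder N)

/-- The two-replica free energy `f⁽²⁾(β, lam)` in the limit `N → ∞`. -/
def freeEnergy2 (β lam : ℝ) : ℝ :=
  limUnder atTop fun N : ℕ => freeEnergy2N N β lam

/-- The critical inverse temperature `2 √(log 2)`. -/
def betaC : ℝ := 2 * Real.sqrt (Real.log 2)

/-- `lam ↓ 0` along the points at which `f` is differentiable. -/
def downToZero (f : ℝ → ℝ) : Filter ℝ :=
  𝓝[{x | 0 < x ∧ DifferentiableAt ℝ f x}] 0

/-- `lam ↑ 0` along the points at which `f` is differentiable. -/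
def upToZero (f : ℝ → ℝ) : Filter ℝ :=
  𝓝[{x | x < 0 ∧ DifferentiableAt ℝ f x}] 0

/-- `lim_{lam ↓ 0} f'(lam)`. -/
def derivLimDown (f : ℝ → ℝ) : ℝ := limUnder (downToZero f) (deriv f)

/-- `lim_{lam ↑ 0} f'(lam)`. -/
def derivLimUp (f : ℝ → ℝ) : ℝ := limUnder (upToZero f) (deriv f)

/-- The jump order parameter
`(1/2) {- lim_{lam ↓ 0} ∂f⁽²⁾/∂lam + lim_{lam ↑ 0} ∂f⁽²⁾/∂lam}`. -/
def qJump (β : ℝ) : ℝ :=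
  (1 / 2) * (-derivLimDown (freeEnergy2 β) + derivLimUp (freeEnergy2 β))

end

end REM

/-! For `β ≥ betaC` the system is frozen: the pressure per spin divided by `β` converges to a
ground-state quantity, `extreme lam`, that does not depend on `β` (`tendsto_freeEnergy2N`). About `2
^ N * N.choose k` ordered pairs lie at Hamming distance `k`, and for distinct configurations `-(E s
+ E t)` has variance `N`, so the largest value at that distance is about `pairLevel N k = √(2 N
logPairs N k)`; the overlap adds `lam * (N - 2 k)`. Identical pairs reach `2 N √(log 2) + lam * N`.
The maximum over these options, per spin, is `extreme lam`.

The upper bound (`integral_log_partition2_le`) is a Chernoff argument with a separate exponential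
tilt for each pair. The optimal tilts never exceed `betaC`, which is where `betaC ≤ β` enters. The
lower bound (`le_integral_of_pairs_le`) is a second-moment argument: splitting a pair's level evenly
asks of each configuration an energy no deeper than `-N √(log 2)`, so single energies are no
obstruction. Fekete's lemma, through `subadditive_neg_pairExtreme`, provides the limit of the
maximum over `k` without computing it.

The jump comes from degeneracy at `lam = 0`. The level `2 √(log 2)` per spin is reached by identical
pairs, with overlap `N`, and asymptotically by pairs at distance about `N / 2`, with overlap about
`0`. Positive coupling selects the former, so `extreme` has slope `1` on the right
(`extreme_of_nonneg`); under negative coupling the latter keep `extreme` at or above its value at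
`0` (`le_extreme_of_nonpos`), so the left slope is at most `0`, which is stronger than the required
bound. Convexity of `extreme` turns one-sided derivatives into limits of derivatives. -/

namespace ConvexOn

/-! ### Derivatives of convex functions on the line -/

/-- A convex function on the line is differentiable off a countable set. -/
theorem countable_not_differentiableAt {g : ℝ → ℝ} (hg : ConvexOn ℝ Set.univ g) :
    {x : ℝ | ¬ DifferentiableAt ℝ g x}.Countable := by
  have hint : ∀ x : ℝ, x ∈ interior (Set.univ : Set ℝ) := fun x => by simp
  -- A monotone function has countably many discontinuities; where the right derivative is
  -- continuous it agrees with the left derivative.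
  have hmono : Monotone fun x => derivWithin g (Set.Ioi x) x := by
    have h := hg.monotoneOn_rightDeriv
    rw [interior_univ, monotoneOn_univ] at h
    exact h
  refine hmono.countable_not_continuousAt.mono ?_
  intro x hx hc
  refine hx ?_
  have hR := hg.hasDerivWithinAt_rightDeriv_of_mem_interior (hint x)
  have hL := hg.hasDerivWithinAt_leftDeriv_of_mem_interior (hint x)
  have hle := hg.leftDeriv_le_rightDeriv_of_mem_interior (hint x)
  have hge : derivWithin g (Set.Ioi x) x ≤ derivWithin g (Set.Iio x) x := by
    refine le_of_tendsto (hc.tendsto.mono_left (nhdsWithin_le_nhds (s := Set.Iio x))) ?_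
    filter_upwards [self_mem_nhdsWithin] with y hy
    exact (hg.rightDeriv_le_slope_of_mem_interior (hint y) (Set.mem_univ x) hy).trans
      (hg.slope_le_leftDeriv_of_mem_interior (Set.mem_univ y) (hint x) hy)
  rw [le_antisymm hle hge] at hL
  have h := hasDerivWithinAt_Iio_iff_Iic.1 hL |>.union (hasDerivWithinAt_Ioi_iff_Ici.1 hR)
  rw [Set.Iic_union_Ici, hasDerivWithinAt_univ] at h
  exact h.differentiableAt

/-- Along points of differentiability the derivative of a convex function tends to the left
derivative from the left. -/
theorem tendsto_deriv_leftDeriv {g : ℝ → ℝ} (hg : ConvexOn ℝ Set.univ g) (a : ℝ) :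
    Tendsto (deriv g) (𝓝[{x | x < a ∧ DifferentiableAt ℝ g x}] a)
      (𝓝 (derivWithin g (Set.Iio a) a)) := by
  have hint : ∀ x : ℝ, x ∈ interior (Set.univ : Set ℝ) := fun x => by simp
  have hL := hg.hasDerivWithinAt_leftDeriv_of_mem_interior (hint a)
  rw [tendsto_order]
  constructor
  · intro c hc
    -- Fix one `y < a` whose chord to `a` is steeper than `c`. By continuity the chord from `y` to
    -- `x` stays steeper than `c` for `x` near `a`, and convexity puts the derivative at `x` above
    -- it.
    have h1 : ∀ᶠ y in 𝓝[<] a, c < slope g a y :=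
      (hasDerivWithinAt_iff_tendsto_slope' (by simp)).1 hL |>.eventually (lt_mem_nhds hc)
    obtain ⟨y, hy, hya⟩ := (h1.and self_mem_nhdsWithin).exists
    have hya : y < a := hya
    have hcont : ContinuousAt g a := by
      have := hg.continuousOn isOpen_univ
      exact this.continuousAt univ_mem
    have h2 : ContinuousAt (slope g y) a := by
      have : ContinuousAt (fun x => (x - y)⁻¹ • (g x -ᵥ g y)) a := by
        simp only [vsub_eq_sub, smul_eq_mul]
        exact ((continuousAt_id.sub continuousAt_const).inv₀
          (sub_ne_zero.2 hya.ne')).mul (hcont.sub continuousAt_const)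
      exact this
    rw [slope_comm] at hy
    have h3 := (h2.eventually (lt_mem_nhds hy)).and (lt_mem_nhds hya)
    filter_upwards [nhdsWithin_le_nhds h3, self_mem_nhdsWithin] with x hx hx'
    exact hx.1.trans_le (hg.slope_le_of_hasDerivWithinAt (Set.mem_univ y) (Set.mem_univ x) hx.2
      hx'.2.hasDerivAt.hasDerivWithinAt)
  · intro c hc
    filter_upwards [self_mem_nhdsWithin] with x hx
    refine lt_of_le_of_lt ?_ hc
    exact (hg.le_slope_of_hasDerivWithinAt (Set.mem_univ x) (Set.mem_univ a) hx.1
      hx.2.hasDerivAt.hasDerivWithinAt).trans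
      (hg.slope_le_leftDeriv_of_mem_interior (Set.mem_univ x) (hint a) hx.1)

end ConvexOn

/-- A point is a left limit of every set with countable complement. -/
theorem nhdsWithin_lt_and_neBot {p : ℝ → Prop} (hp : {x | ¬ p x}.Countable) (a : ℝ) :
    (𝓝[{x | x < a ∧ p x}] a).NeBot := by
  rw [← mem_closure_iff_nhdsWithin_neBot]
  have hd : Dense {x | p x} := by
    have := hp.dense_compl ℝ
    simpa [Set.compl_ofPred] using this
  have := hd.open_subset_closure_inter (isOpen_Iio (a := a))
  have h2 : a ∈ closure (Set.Iio a) := by simp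
  exact closure_minimal this isClosed_closure h2

namespace REM

noncomputable section

/-! ### Overlaps and Hamming distances -/

theorem dot_eq {N : ℕ} (s t : Config N) : dot s t = N - 2 * hammingDist s t := by
  have h : ∀ j, ((s j : ℤ) : ℝ) * ((t j : ℤ) : ℝ) = 1 - 2 * (if s j ≠ t j then 1 else 0) := by
    intro j
    rcases Int.units_eq_one_or (s j) with h1 | h1 <;> rcases Int.units_eq_one_or (t j) with h2 | h2
    all_goals simp [h1, h2]
    all_goals norm_num
  simp only [dot, h, hammingDist, Finset.sum_sub_distrib, ← Finset.mul_sum, Finset.sum_boole]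
  simp

theorem card_hammingDist_eq {N : ℕ} (s : Config N) (k : ℕ) :
    (Finset.univ.filter fun t : Config N => hammingDist s t = k).card = N.choose k := by
  have h := Finset.card_powersetCard k (Finset.univ : Finset (Fin N))
  rw [Finset.card_univ, Fintype.card_fin] at h
  rw [← h]
  -- A configuration is determined by the set of sites where it differs from `s`.
  refine Finset.card_bij' (fun t _ => Finset.univ.filter fun j => s j ≠ t j)
    (fun A _ j => if j ∈ A then -s j else s j) ?_ ?_ ?_ ?_
  · intro t ht
    simpa [Finset.mem_powersetCard, hammingDist] using ht
  · intro A hA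
    have hA := (Finset.mem_powersetCard.1 hA).2
    have : (Finset.univ.filter fun j => s j ≠ if j ∈ A then -s j else s j) = A := by
      ext j
      by_cases hj : j ∈ A
      · simp [hj]
      · simp [hj]
    simpa [hammingDist, this] using hA
  · intro t _
    funext j
    by_cases hj : s j = t j
    · simp [hj]
    · have := Int.units_ne_iff_eq_neg.1 hj
      simp [this]
  · intro A _
    ext j
    by_cases hj : j ∈ A
    · simp [hj]
    · simp [hj]

theorem card_config (N : ℕ) : Fintype.card (Config N) = 2 ^ N := by
  simp [Config]

/-! ### Extreme levels of pairs and their limit per spin -/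

/-- The logarithm of the number of ordered pairs of configurations at Hamming distance `k`. -/
def logPairs (N k : ℕ) : ℝ := Real.log (2 ^ N * N.choose k)

/-- The extreme value of `-(E_s + E_t)` expected among pairs at Hamming distance `k`. -/
def pairLevel (N k : ℕ) : ℝ := Real.sqrt (2 * N * logPairs N k)

/-- The extreme value of `-(E_s + E_t) + lam s·t` expected among pairs of distinct
configurations. -/
def pairExtreme (lam : ℝ) (N : ℕ) : ℝ :=
  (Finset.range (N + 1)).sup' ⟨0, by simp⟩ fun k => lam * (N - 2 * k) + pairLevel N k

theorem exp_logPairs {N k : ℕ} (hk : k ≤ N) :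
    Real.exp (logPairs N k) = 2 ^ N * N.choose k := by
  have := Nat.choose_pos hk
  exact Real.exp_log (by positivity)

theorem le_logPairs {N k : ℕ} (hk : k ≤ N) : N * Real.log 2 ≤ logPairs N k := by
  have h := Nat.choose_pos hk
  rw [logPairs, ← Real.log_pow]
  refine Real.log_le_log (by positivity) ?_
  have : (1 : ℝ) ≤ N.choose k := by exact_mod_cast h
  nlinarith [show (0 : ℝ) < 2 ^ N by positivity]

theorem logPairs_nonneg {N k : ℕ} (hk : k ≤ N) : 0 ≤ logPairs N k :=
  le_trans (by positivity) (le_logPairs hk)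

theorem logPairs_le {N k : ℕ} (hk : k ≤ N) : logPairs N k ≤ 2 * N * Real.log 2 := by
  have h := Nat.choose_pos hk
  have h2 : (N.choose k : ℝ) ≤ 2 ^ N := by exact_mod_cast Nat.choose_le_two_pow N k
  calc logPairs N k ≤ Real.log (2 ^ N * 2 ^ N) := Real.log_le_log (by positivity) (by gcongr)
    _ = 2 * N * Real.log 2 := by rw [← pow_add, Real.log_pow]; push_cast; ring

/-- The central binomial coefficient is the largest of `N + 1` terms summing to `2 ^ N`. The upper
middle `N - N / 2` is used because its overlap is nonpositive and it is positive as soon as `N` is.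
-/
theorem le_logPairs_middle (N : ℕ) :
    2 * N * Real.log 2 - Real.log (N + 1) ≤ logPairs N (N - N / 2) := by
  have h : (2 : ℝ) ^ N ≤ (N + 1) * N.choose (N - N / 2) := by
    rw [Nat.choose_symm (Nat.div_le_self N 2)]
    have : 2 ^ N ≤ (N + 1) * N.choose (N / 2) := by
      rw [← Nat.sum_range_choose]
      refine (Finset.sum_le_card_nsmul _ _ _ fun r _ => Nat.choose_le_middle r N).trans ?_
      simp
    exact_mod_cast this
  have hp := Nat.choose_pos (Nat.sub_le N (N / 2))
  rw [sub_le_iff_le_add, logPairs, ← Real.log_mul (by positivity) (by positivity)]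
  calc 2 * N * Real.log 2 = Real.log (2 ^ N * 2 ^ N) := by
        rw [← pow_add, Real.log_pow]; push_cast; ring
    _ ≤ _ := by
      refine Real.log_le_log (by positivity) ?_
      nlinarith [show (0 : ℝ) < 2 ^ N by positivity]

theorem pairLevel_sq {N k : ℕ} (hk : k ≤ N) : pairLevel N k ^ 2 = 2 * N * logPairs N k := by
  have := logPairs_nonneg hk
  exact Real.sq_sqrt (by positivity)

/-- Two uses: the tilt `pairLevel N k / N` is at most `betaC`, and half the level is within reach of
a single energy. -/
theorem pairLevel_le {N k : ℕ} (hk : k ≤ N) : pairLevel N k ≤ 2 * N * Real.sqrt (Real.log 2) := by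
  have h2 : 0 ≤ Real.log 2 := by positivity
  refine Real.sqrt_le_iff.2 ⟨by positivity, ?_⟩
  rw [mul_pow, Real.sq_sqrt h2]
  nlinarith [logPairs_le hk, show (0 : ℝ) ≤ N by positivity]

theorem le_pairLevel {N k : ℕ} (hk : k ≤ N) : N * Real.sqrt (Real.log 2) ≤ pairLevel N k := by
  have h2 : 0 ≤ Real.log 2 := by positivity
  refine Real.le_sqrt_of_sq_le ?_
  rw [mul_pow, Real.sq_sqrt h2]
  have hN : (0 : ℝ) ≤ N := by positivity
  nlinarith [le_logPairs hk, mul_nonneg hN (logPairs_nonneg hk)]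

theorem tendsto_pairLevel_middle :
    Tendsto (fun N : ℕ => pairLevel N (N - N / 2) / N) atTop (𝓝 (2 * Real.sqrt (Real.log 2))) := by
  have h2 : 0 ≤ Real.log 2 := by positivity
  have hlog : Tendsto (fun N : ℕ => Real.log ((N : ℝ) + 1) / N) atTop (𝓝 0) := by
    have h := (Real.isLittleO_log_id_atTop.tendsto_div_nhds_zero.comp
      (tendsto_natCast_atTop_atTop.comp (tendsto_add_atTop_nat 1)))
    have h' : Tendsto (fun N : ℕ => ((N : ℝ) + 1) / N) atTop (𝓝 1) := by
      have := (tendsto_inv_atTop_nhds_zero_nat (𝕜 := ℝ)).const_add 1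
      rw [add_zero] at this
      refine this.congr' ?_
      filter_upwards [eventually_gt_atTop 0] with N hN
      have : (N : ℝ) ≠ 0 := by positivity
      field_simp
    have := h.mul h'
    rw [zero_mul] at this
    refine this.congr' ?_
    filter_upwards [eventually_gt_atTop 0] with N hN
    have : (N : ℝ) ≠ 0 := by positivity
    have : (N : ℝ) + 1 ≠ 0 := by positivity
    simp only [Function.comp, id, Nat.cast_add, Nat.cast_one]
    field_simp
  have hlow : Tendsto (fun N : ℕ => Real.sqrt (4 * Real.log 2 - 2 * (Real.log ((N : ℝ) + 1) / N)))
      atTop (𝓝 (2 * Real.sqrt (Real.log 2))) := by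
    have h := (tendsto_const_nhds (x := 4 * Real.log 2)).sub (hlog.const_mul 2)
    have h' := (Real.continuous_sqrt.tendsto _).comp h
    have e : Real.sqrt (4 * Real.log 2 - 2 * 0) = 2 * Real.sqrt (Real.log 2) := by
      rw [mul_zero, sub_zero, Real.sqrt_mul (by norm_num), show (4 : ℝ) = 2 ^ 2 by norm_num,
        Real.sqrt_sq (by norm_num)]
    rw [e] at h'
    exact h'
  refine tendsto_of_tendsto_of_tendsto_of_le_of_le' hlow tendsto_const_nhds ?_ ?_
  · filter_upwards [eventually_gt_atTop 0] with N hN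
    have hN' : (0 : ℝ) < N := by positivity
    rw [le_div_iff₀ hN']
    refine Real.le_sqrt_of_sq_le ?_
    rw [mul_pow]
    have hm := le_logPairs_middle N
    by_cases hs : 0 ≤ 4 * Real.log 2 - 2 * (Real.log ((N : ℝ) + 1) / N)
    · rw [Real.sq_sqrt hs]
      calc _ = 2 * N * (2 * N * Real.log 2 - Real.log (N + 1)) := by field_simp; ring
        _ ≤ _ := by gcongr
    · rw [Real.sqrt_eq_zero_of_nonpos (not_le.1 hs).le]
      have := logPairs_nonneg (Nat.sub_le N (N / 2))
      simp only [ne_eq, OfNat.ofNat_ne_zero, not_false_eq_true, zero_pow, zero_mul]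
      positivity
  · filter_upwards [eventually_gt_atTop 0] with N hN
    have hN' : (0 : ℝ) < N := by positivity
    rw [div_le_iff₀ hN']
    linarith [pairLevel_le (Nat.sub_le N (N / 2))]

theorem le_pairExtreme (lam : ℝ) {N k : ℕ} (hk : k ≤ N) :
    lam * (N - 2 * k) + pairLevel N k ≤ pairExtreme lam N :=
  Finset.le_sup' (fun k : ℕ => lam * ((N : ℝ) - 2 * k) + pairLevel N k)
    (Finset.mem_range.2 (Nat.lt_succ_of_le hk))

theorem exists_pairExtreme_eq (lam : ℝ) (N : ℕ) :
    ∃ k ≤ N, pairExtreme lam N = lam * (N - 2 * k) + pairLevel N k := by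
  obtain ⟨k, hk, h⟩ := Finset.exists_mem_eq_sup' (s := Finset.range (N + 1)) ⟨0, by simp⟩
    fun k : ℕ => lam * ((N : ℝ) - 2 * k) + pairLevel N k
  exact ⟨k, Nat.le_of_lt_succ (Finset.mem_range.1 hk), h⟩

theorem pairExtreme_le (lam : ℝ) (N : ℕ) :
    pairExtreme lam N ≤ N * (|lam| + 2 * Real.sqrt (Real.log 2)) := by
  obtain ⟨k, hk, h⟩ := exists_pairExtreme_eq lam N
  have hk' : (k : ℝ) ≤ N := by exact_mod_cast hk
  have h0 : (0 : ℝ) ≤ k := by positivity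
  have h1 : lam * (N - 2 * k) ≤ |lam| * N := by
    refine (le_abs_self _).trans ?_
    rw [abs_mul]
    gcongr
    rw [abs_le]
    constructor <;> linarith
  linarith [pairLevel_le hk]

/-- One term of Vandermonde's sum is at most the whole; concatenation of pairs is the combinatorial
picture. -/
theorem logPairs_add {M N k l : ℕ} (hk : k ≤ M) (hl : l ≤ N) :
    logPairs M k + logPairs N l ≤ logPairs (M + N) (k + l) := by
  have h1 := Nat.choose_pos hk
  have h2 := Nat.choose_pos hl
  have h3 : M.choose k * N.choose l ≤ (M + N).choose (k + l) := by
    rw [Nat.add_choose_eq]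
    exact Finset.single_le_sum (f := fun ij : ℕ × ℕ => M.choose ij.1 * N.choose ij.2)
      (fun _ _ => Nat.zero_le _) (Finset.HasAntidiagonal.mem_antidiagonal.2 (rfl : (k, l).1 + (k, l).2 = k + l))
  have h3' : (M.choose k : ℝ) * N.choose l ≤ (M + N).choose (k + l) := by exact_mod_cast h3
  rw [logPairs, logPairs, logPairs, ← Real.log_mul (by positivity) (by positivity)]
  refine Real.log_le_log (by positivity) ?_
  rw [pow_add]
  nlinarith [show (0 : ℝ) < 2 ^ M * 2 ^ N by positivity]

/-- Cauchy–Schwarz in the form `√(M A) + √(N B) ≤ √((M + N) (A + B))`, combined with superadditivity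
of `logPairs`. -/
theorem pairLevel_add {M N k l : ℕ} (hk : k ≤ M) (hl : l ≤ N) :
    pairLevel M k + pairLevel N l ≤ pairLevel (M + N) (k + l) := by
  refine Real.le_sqrt_of_sq_le ?_
  have hA := logPairs_nonneg hk
  have hB := logPairs_nonneg hl
  have hM : (0 : ℝ) ≤ M := by positivity
  have hN : (0 : ℝ) ≤ N := by positivity
  have hcs : pairLevel M k * pairLevel N l ≤ M * logPairs N l + N * logPairs M k := by
    rw [pairLevel, pairLevel, ← Real.sqrt_mul (by positivity)]
    refine Real.sqrt_le_iff.2 ⟨by positivity, ?_⟩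
    nlinarith [sq_nonneg (M * logPairs N l - N * logPairs M k)]
  calc (pairLevel M k + pairLevel N l) ^ 2
      = pairLevel M k ^ 2 + pairLevel N l ^ 2 + 2 * (pairLevel M k * pairLevel N l) := by ring
    _ ≤ 2 * (M + N) * (logPairs M k + logPairs N l) := by
      rw [pairLevel_sq hk, pairLevel_sq hl]; nlinarith
    _ ≤ _ := by
      push_cast
      have := logPairs_add hk hl
      gcongr

/-- The overlap term is additive in the size and distance, so adding the optimal distances for `M`
and `N` gives a competitor for `M + N`. -/
theorem subadditive_neg_pairExtreme (lam : ℝ) : Subadditive fun N => -pairExtreme lam N := by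
  intro M N
  obtain ⟨k, hk, h⟩ := exists_pairExtreme_eq lam M
  obtain ⟨l, hl, h'⟩ := exists_pairExtreme_eq lam N
  have h1 := le_pairExtreme lam (add_le_add hk hl)
  have h2 := pairLevel_add hk hl
  push_cast at h1
  simp only
  rw [h, h']
  linarith

/-- The limit of `pairExtreme lam N / N`. -/
def pairExtremeLim (lam : ℝ) : ℝ := -(subadditive_neg_pairExtreme lam).lim

theorem tendsto_pairExtreme (lam : ℝ) :
    Tendsto (fun N : ℕ => pairExtreme lam N / N) atTop (𝓝 (pairExtremeLim lam)) := by
  have h := (subadditive_neg_pairExtreme lam).tendsto_lim ?_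
  · refine h.neg.congr fun N => ?_
    ring
  · refine ⟨-(|lam| + 2 * Real.sqrt (Real.log 2)), ?_⟩
    rintro _ ⟨N, rfl⟩
    rcases Nat.eq_zero_or_pos N with rfl | hN
    · simp only [Nat.cast_zero, div_zero]
      have : 0 ≤ |lam| + 2 * Real.sqrt (Real.log 2) := by positivity
      linarith
    · have hN' : (0 : ℝ) < N := by positivity
      simp only
      rw [le_div_iff₀ hN']
      linarith [pairExtreme_le lam N]

/-- The limiting extreme value per spin of `-(E_s + E_t) + lam s·t` over all pairs. -/
def extreme (lam : ℝ) : ℝ := max (pairExtremeLim lam) (2 * Real.sqrt (Real.log 2) + lam)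

/-- At finite `N` this is a maximum of functions affine in `lam`; convexity survives the pointwise
limit. -/
theorem convexOn_pairExtremeLim : ConvexOn ℝ Set.univ pairExtremeLim := by
  refine ⟨convex_univ, fun x _ y _ a b ha hb hab => ?_⟩
  refine le_of_tendsto_of_tendsto (tendsto_pairExtreme _)
    (((tendsto_pairExtreme x).const_smul a).add ((tendsto_pairExtreme y).const_smul b)) ?_
  refine Eventually.of_forall fun N => ?_
  obtain ⟨k, hk, h⟩ := exists_pairExtreme_eq (a • x + b • y) N
  simp only [smul_eq_mul] at h ⊢
  rw [h, ← mul_div_assoc, ← mul_div_assoc, ← add_div]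
  refine div_le_div_of_nonneg_right ?_ (by positivity)
  have h1 := mul_le_mul_of_nonneg_left (le_pairExtreme x hk) ha
  have h2 := mul_le_mul_of_nonneg_left (le_pairExtreme y hk) hb
  have h3 : pairLevel N k = a * pairLevel N k + b * pairLevel N k := by rw [← add_mul, hab, one_mul]
  linarith

theorem convexOn_extreme : ConvexOn ℝ Set.univ extreme := by
  refine convexOn_pairExtremeLim.sup ?_
  refine ⟨convex_univ, fun x _ y _ a b ha hb hab => le_of_eq ?_⟩
  simp only [smul_eq_mul]
  linear_combination (-(2 * Real.sqrt (Real.log 2))) * hab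

/-- Identical pairs attain the maximal level and the maximal overlap simultaneously. -/
theorem extreme_of_nonneg {lam : ℝ} (h : 0 ≤ lam) :
    extreme lam = 2 * Real.sqrt (Real.log 2) + lam := by
  refine max_eq_right (le_of_tendsto (tendsto_pairExtreme lam) ?_)
  filter_upwards [eventually_gt_atTop 0] with N hN
  have hN' : (0 : ℝ) < N := by positivity
  rw [div_le_iff₀ hN']
  have := pairExtreme_le lam N
  rw [abs_of_nonneg h] at this
  linarith

/-- At distance `N - N / 2` the level is asymptotically maximal while the overlap is nonpositive, so
negative coupling costs nothing there. -/
theorem le_extreme_of_nonpos {lam : ℝ} (h : lam ≤ 0) :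
    2 * Real.sqrt (Real.log 2) ≤ extreme lam := by
  refine le_max_of_le_left (le_of_tendsto_of_tendsto tendsto_pairLevel_middle
    (tendsto_pairExtreme lam) (Eventually.of_forall fun N => ?_))
  refine div_le_div_of_nonneg_right ?_ (by positivity)
  have h1 := le_pairExtreme lam (Nat.sub_le N (N / 2))
  have h2 : (N : ℝ) ≤ 2 * ((N - N / 2 : ℕ) : ℝ) := by
    have : N ≤ 2 * (N - N / 2) := by omega
    exact_mod_cast this
  nlinarith [mul_nonneg_of_nonpos_of_nonpos h (show (N : ℝ) - 2 * ((N - N / 2 : ℕ) : ℝ) ≤ 0 by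
    linarith)]

/-! ### Gaussian moments of the disorder -/

instance isProbabilityMeasure_disorder (N : ℕ) : IsProbabilityMeasure (disorder N) := by
  unfold disorder; infer_instance

theorem integrable_eval {N : ℕ} (s : Config N) : Integrable (fun E => E s) (disorder N) := by
  have h : Integrable (fun x : ℝ => x) (gaussianReal 0 ((N : NNReal) / 2)) :=
    (memLp_id_gaussianReal 1).integrable (by simp)
  exact integrable_comp_eval (μ := fun _ : Config N => gaussianReal 0 ((N : NNReal) / 2)) h

theorem integral_abs_eval_le {N : ℕ} (hN : 0 < N) (s : Config N) :
    ∫ E, |E s| ∂(disorder N) ≤ Real.sqrt N := by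
  set γ := gaussianReal 0 ((N : NNReal) / 2)
  have hN' : (0 : ℝ) < Real.sqrt N := Real.sqrt_pos.2 (by positivity)
  have hsq : Real.sqrt N * Real.sqrt N = N := Real.mul_self_sqrt (by positivity)
  have e : ∫ E, |E s| ∂(disorder N) = ∫ x, |x| ∂γ :=
    integral_comp_eval (μ := fun _ : Config N => gaussianReal 0 ((N : NNReal) / 2))
      (f := fun x : ℝ => |x|) (by fun_prop)
  have hL : MemLp id 2 γ := memLp_id_gaussianReal 2
  have h2 : ∫ x, x ^ 2 ∂γ = N / 2 := by
    have h := variance_eq_sub hL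
    rw [variance_id_gaussianReal] at h
    have h0 : ∫ x, id x ∂γ = 0 := integral_id_gaussianReal
    rw [h0] at h
    simpa using h.symm
  have hi1 : Integrable (fun x : ℝ => |x|) γ := ((memLp_id_gaussianReal 1).integrable (by simp)).abs
  have hi2 : Integrable (fun x : ℝ => x ^ 2) γ := hL.integrable_sq
  rw [e]
  -- AM–GM between `√N` and `|x|` reduces the first absolute moment to the variance.
  calc ∫ x, |x| ∂γ ≤ ∫ x, (Real.sqrt N / 2 + (2 * Real.sqrt N)⁻¹ * x ^ 2) ∂γ := by
        refine integral_mono hi1 ((integrable_const _).add (hi2.const_mul _)) fun x => ?_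
        have : Real.sqrt N / 2 + (2 * Real.sqrt N)⁻¹ * x ^ 2 - |x|
            = (2 * Real.sqrt N)⁻¹ * (Real.sqrt N - |x|) ^ 2 := by
          rw [← sq_abs x]; field_simp; ring
        have h3 : 0 ≤ (2 * Real.sqrt N)⁻¹ * (Real.sqrt N - |x|) ^ 2 := by positivity
        simp only
        linarith
    _ = Real.sqrt N / 2 + (2 * Real.sqrt N)⁻¹ * (N / 2) := by
        rw [integral_add (integrable_const _) (hi2.const_mul _), integral_const_mul, h2]
        simp
    _ ≤ Real.sqrt N := by
        have : (2 * Real.sqrt N)⁻¹ * (N / 2) = Real.sqrt N / 4 := by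
          rw [← hsq, Real.sqrt_mul_self hN'.le]; field_simp; ring
        rw [this]; linarith

theorem integrable_exp_sum {N : ℕ} (c : Config N → ℝ) :
    Integrable (fun E => Real.exp (∑ x, c x * E x)) (disorder N) := by
  simp_rw [Real.exp_sum]
  exact Integrable.fintype_prod (f := fun i x => Real.exp (c i * x))
    fun i => integrable_exp_mul_gaussianReal (c i)

theorem integral_exp_sum {N : ℕ} (c : Config N → ℝ) :
    ∫ E, Real.exp (∑ x, c x * E x) ∂(disorder N) = Real.exp (N / 4 * ∑ x, c x ^ 2) := by
  simp_rw [Real.exp_sum]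
  rw [Finset.mul_sum, Real.exp_sum]
  refine (integral_fintype_prod_eq_prod (fun (i : Config N) (x : ℝ) => Real.exp (c i * x))).trans ?_
  refine Finset.prod_congr rfl fun i _ => ?_
  have h := congrFun (mgf_id_gaussianReal (μ := 0) (v := (N : NNReal) / 2)) (c i)
  simp only [mgf, id] at h
  rw [h]
  congr 1
  push_cast
  ring

theorem sum_pair_mul {N : ℕ} (a : ℝ) (s t : Config N) (E : Config N → ℝ) :
    ∑ x, (a * ((if x = s then 1 else 0) + if x = t then 1 else 0)) * E x = a * (E s + E t) := by
  simp_rw [mul_assoc, ← Finset.mul_sum, add_mul, Finset.sum_add_distrib]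
  simp

theorem integrable_exp_pair {N : ℕ} (a : ℝ) (s t : Config N) :
    Integrable (fun E => Real.exp (a * (E s + E t))) (disorder N) := by
  simpa only [sum_pair_mul] using
    integrable_exp_sum fun x => a * ((if x = s then 1 else 0) + if x = t then 1 else 0)

/-- The factor `2` or `1` records the variance of `E s + E t`: `2 N` if the configurations coincide,
`N` otherwise. -/
theorem integral_exp_pair {N : ℕ} (a : ℝ) (s t : Config N) :
    ∫ E, Real.exp (a * (E s + E t)) ∂(disorder N)
      = Real.exp (a ^ 2 * N / 2 * if s = t then 2 else 1) := by
  have h := integral_exp_sum fun x => a * ((if x = s then 1 else 0) + if x = t then 1 else 0)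
  simp only [sum_pair_mul] at h
  rw [h]
  congr 1
  have : ∀ x, (a * ((if x = s then 1 else 0) + if x = t then 1 else 0)) ^ 2
      = a ^ 2 * (if x = s then 1 else 0) + a ^ 2 * (if x = t then 1 else 0)
        + (2 * a ^ 2 * if s = t then 1 else 0) * (if x = s then 1 else 0) := by
    intro x
    by_cases h1 : x = s
    · subst h1
      by_cases h2 : x = t
      · simp [h2]; ring
      · simp [h2]
    · by_cases h2 : x = t
      · subst h2
        simp [h1]
      · simp [h1, h2]
  simp_rw [this, Finset.sum_add_distrib, ← Finset.mul_sum, Finset.sum_ite_eq', Finset.mem_univ,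
    if_true]
  split_ifs <;> simp <;> ring

/-! ### Integrability of the logarithm of the partition function -/

theorem partition2_pos {N : ℕ} (E : Config N → ℝ) (β lam : ℝ) : 0 < partition2 E β lam :=
  Finset.sum_pos (fun _ _ => Finset.sum_pos (fun _ _ => Real.exp_pos _) Finset.univ_nonempty)
    Finset.univ_nonempty

theorem le_log_partition2 {N : ℕ} (E : Config N → ℝ) (β lam : ℝ) (s t : Config N) :
    -β * hamiltonian2 E lam s t ≤ Real.log (partition2 E β lam) := by
  rw [Real.le_log_iff_exp_le (partition2_pos E β lam)]
  calc Real.exp (-β * hamiltonian2 E lam s t)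
      ≤ ∑ t, Real.exp (-β * hamiltonian2 E lam s t) :=
        Finset.single_le_sum (f := fun t => Real.exp (-β * hamiltonian2 E lam s t))
          (fun _ _ => (Real.exp_pos _).le) (Finset.mem_univ t)
    _ ≤ partition2 E β lam :=
        Finset.single_le_sum (f := fun s => ∑ t, Real.exp (-β * hamiltonian2 E lam s t))
          (fun _ _ => Finset.sum_nonneg fun _ _ => (Real.exp_pos _).le) (Finset.mem_univ s)

theorem abs_dot_le {N : ℕ} (s t : Config N) : |dot s t| ≤ N := by
  have h : (hammingDist s t : ℝ) ≤ N := by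
    exact_mod_cast (hammingDist_le_card_fintype (x := s) (y := t)).trans_eq (by simp)
  have h0 : (0 : ℝ) ≤ hammingDist s t := by positivity
  rw [dot_eq, abs_le]
  constructor <;> linarith

theorem abs_log_partition2_le {N : ℕ} (E : Config N → ℝ) (β lam : ℝ) :
    |Real.log (partition2 E β lam)|
      ≤ |β| * (2 * ∑ s, |E s| + |lam| * N) + Real.log (2 ^ N * 2 ^ N) := by
  set B := |β| * (2 * ∑ s, |E s| + |lam| * N) with hB
  have hH : ∀ s t, |-β * hamiltonian2 E lam s t| ≤ B := by
    intro s t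
    have hs : ∀ s, |E s| ≤ ∑ s, |E s| := fun s =>
      Finset.single_le_sum (f := fun s => |E s|) (fun _ _ => abs_nonneg _) (Finset.mem_univ s)
    rw [abs_mul, abs_neg, hB]
    gcongr
    calc |hamiltonian2 E lam s t| ≤ |E s| + |E t| + |lam * dot s t| :=
          (abs_sub _ _).trans (by gcongr; exact abs_add_le _ _)
      _ ≤ _ := by
        rw [abs_mul]
        have := mul_le_mul_of_nonneg_left (abs_dot_le s t) (abs_nonneg lam)
        linarith [hs s, hs t]
  have hpow : 0 ≤ Real.log (2 ^ N * 2 ^ N) :=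
    Real.log_nonneg (one_le_mul_of_one_le_of_one_le (one_le_pow₀ (by norm_num))
      (one_le_pow₀ (by norm_num)))
  rw [abs_le]
  constructor
  · have h1 := le_log_partition2 E β lam 1 1
    have h2 := (abs_le.1 (hH 1 1)).1
    linarith
  · have h : partition2 E β lam ≤ 2 ^ N * 2 ^ N * Real.exp B := by
      calc partition2 E β lam ≤ ∑ _s : Config N, ∑ _t : Config N, Real.exp B := by
            unfold partition2
            gcongr with s _ t _
            exact (abs_le.1 (hH s t)).2
        _ = _ := by simp; ring
    calc Real.log (partition2 E β lam) ≤ Real.log (2 ^ N * 2 ^ N * Real.exp B) :=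
          Real.log_le_log (partition2_pos E β lam) h
      _ = _ := by rw [Real.log_mul (by positivity) (by positivity), Real.log_exp]; ring

theorem integrable_log_partition2 (N : ℕ) (β lam : ℝ) :
    Integrable (fun E => Real.log (partition2 E β lam)) (disorder N) := by
  have hm : Measurable fun E : Config N → ℝ => Real.log (partition2 E β lam) := by
    unfold partition2 hamiltonian2
    fun_prop
  refine Integrable.mono' (g := fun E => |β| * (2 * ∑ s, |E s| + |lam| * N)
    + Real.log (2 ^ N * 2 ^ N)) ?_ hm.aestronglyMeasurable
    (Eventually.of_forall fun E => abs_log_partition2_le E β lam)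
  exact ((((integrable_finsetSum _ fun s _ => (integrable_eval s).abs).const_mul 2).add
    (integrable_const _)).const_mul _).add (integrable_const _)

/-! ### Upper bound: Chernoff tilts, one for each pair -/

/-- If every `exp (b i * (x i - v i))` is moderate, then the low-temperature sum is governed by the
largest level `v i + l i`. -/
theorem log_sum_exp_le {ι : Type*} [Fintype ι] [Nonempty ι] (x v l b : ι → ℝ) {β b₀ G : ℝ}
    (hb₀ : 0 < b₀) (hb : ∀ i, b₀ ≤ b i) (hβ : ∀ i, b i ≤ β) (hG : ∀ i, v i + l i ≤ G) :
    Real.log (∑ i, Real.exp (β * (x i + l i)))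
      ≤ β * G + β / b₀ * Real.log (1 + ∑ i, Real.exp (b i * (x i - v i))) := by
  set Y := ∑ i, Real.exp (b i * (x i - v i)) with hY
  have hY0 : 0 ≤ Y := Finset.sum_nonneg fun _ _ => (Real.exp_pos _).le
  have hβ0 : 0 < β := by
    obtain ⟨i⟩ := ‹Nonempty ι›
    exact hb₀.trans_le ((hb i).trans (hβ i))
  have hlog : 0 ≤ Real.log (1 + Y) := Real.log_nonneg (by linarith)
  have key : ∀ i, Real.exp (β * (x i + l i)) ≤ Real.exp (β * G)
      * (Real.exp (b i * (x i - v i)) * Real.exp ((β / b₀ - 1) * Real.log (1 + Y))) := by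
    intro i
    rw [← Real.exp_add, ← Real.exp_add, Real.exp_le_exp]
    have hbi : 0 < b i := hb₀.trans_le (hb i)
    have h1 : b i * (x i - v i) ≤ Real.log (1 + Y) := by
      rw [Real.le_log_iff_exp_le (by linarith)]
      have : Real.exp (b i * (x i - v i)) ≤ Y :=
        Finset.single_le_sum (f := fun i => Real.exp (b i * (x i - v i)))
          (fun _ _ => (Real.exp_pos _).le) (Finset.mem_univ i)
      linarith
    -- One factor at tilt `b i` is kept so that it can be summed to `Y`; the excess tilt,
    -- nonnegative since `b i ≤ β`, is paid for by the uniform bound `log (1 + Y)`.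
    have h2 : β * (x i - v i) = b i * (x i - v i) + (β / b i - 1) * (b i * (x i - v i)) := by
      field_simp; ring
    have h3 : 0 ≤ β / b i - 1 := by rw [sub_nonneg, one_le_div hbi]; exact hβ i
    have h4 : (β / b i - 1) * (b i * (x i - v i)) ≤ (β / b₀ - 1) * Real.log (1 + Y) :=
      (mul_le_mul_of_nonneg_left h1 h3).trans (mul_le_mul_of_nonneg_right
        (by have := div_le_div_of_nonneg_left hβ0.le hb₀ (hb i); linarith) hlog)
    nlinarith [mul_le_mul_of_nonneg_left (hG i) hβ0.le]
  have hpos : 0 < ∑ i, Real.exp (β * (x i + l i)) :=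
    Finset.sum_pos (fun _ _ => Real.exp_pos _) Finset.univ_nonempty
  rw [Real.log_le_iff_le_exp hpos]
  refine (Finset.sum_le_sum fun i _ => key i).trans ?_
  rw [← Finset.mul_sum, ← Finset.sum_mul, ← hY, Real.exp_add]
  gcongr
  calc Y * Real.exp ((β / b₀ - 1) * Real.log (1 + Y))
      ≤ Real.exp (Real.log (1 + Y)) * Real.exp ((β / b₀ - 1) * Real.log (1 + Y)) := by
        gcongr
        rw [Real.exp_log (by linarith)]
        linarith
    _ = _ := by rw [← Real.exp_add]; congr 1; ring

/-- The weight is the reciprocal of the number of ordered pairs at that distance, so each of the `N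
+ 1` distances contributes `1`. -/
theorem sum_exp_neg_logPairs (N : ℕ) :
    ∑ s : Config N, ∑ t : Config N, Real.exp (-logPairs N (hammingDist s t)) = N + 1 := by
  have h : ∀ s : Config N, ∑ t : Config N, Real.exp (-logPairs N (hammingDist s t))
      = (N + 1) * (2 ^ N)⁻¹ := by
    intro s
    rw [← Finset.sum_fiberwise_of_maps_to (s := Finset.univ) (t := Finset.range (N + 1))
      (g := fun t : Config N => hammingDist s t)]
    · have : ∀ k ∈ Finset.range (N + 1), ∑ t : Config N with hammingDist s t = k,
          Real.exp (-logPairs N (hammingDist s t)) = (2 ^ N)⁻¹ := by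
        intro k hk
        have hk' : k ≤ N := Nat.le_of_lt_succ (Finset.mem_range.1 hk)
        rw [Finset.sum_congr rfl (g := fun _ => Real.exp (-logPairs N k))
          (fun t ht => by rw [(Finset.mem_filter.1 ht).2])]
        have hc := Nat.choose_pos hk'
        have hc' : (N.choose k : ℝ) ≠ 0 := by positivity
        rw [Finset.sum_const, card_hammingDist_eq, Real.exp_neg, exp_logPairs hk', nsmul_eq_mul]
        field_simp
      rw [Finset.sum_congr rfl this]
      simp
    · intro t _
      have := hammingDist_le_card_fintype (x := s) (y := t)
      simp only [Fintype.card_fin] at this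
      simpa using Nat.lt_succ_of_le this
  simp_rw [h, Finset.sum_const, Finset.card_univ, card_config, nsmul_eq_mul]
  push_cast
  field_simp

/-- Upper bound on the averaged two-replica pressure in the frozen phase. -/
theorem integral_log_partition2_le {N : ℕ} (hN : 0 < N) {β : ℝ} (hβ : betaC ≤ β) (lam : ℝ) :
    ∫ E, Real.log (partition2 E β lam) ∂(disorder N)
      ≤ β * max (pairExtreme lam N) (N * (2 * Real.sqrt (Real.log 2) + lam))
        + β / Real.sqrt (Real.log 2) * Real.log (N + 2) := by
  have hN' : (0 : ℝ) < N := by positivity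
  have hl2 : 0 < Real.log 2 := by positivity
  set r := Real.sqrt (Real.log 2) with hr
  have hr0 : 0 < r := Real.sqrt_pos.2 hl2
  have hrr : r ^ 2 = Real.log 2 := Real.sq_sqrt hl2.le
  have hβ' : 2 * r ≤ β := hβ
  have hd : ∀ s t : Config N, hammingDist s t ≤ N := fun s t => by
    simpa using hammingDist_le_card_fintype (x := s) (y := t)
  -- The tilt is the level divided by the variance (`N` off the diagonal, `2 N` on it), the Chernoff
  -- optimum. Each tilted mean is then `exp (-logPairs)`, including on the diagonal, where there are
  -- `2 ^ N` pairs.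
  let v : Config N × Config N → ℝ := fun i =>
    if i.1 = i.2 then 2 * N * r else pairLevel N (hammingDist i.1 i.2)
  let b : Config N × Config N → ℝ := fun i =>
    if i.1 = i.2 then r else pairLevel N (hammingDist i.1 i.2) / N
  set G := max (pairExtreme lam N) (N * (2 * r + lam)) with hGdef
  have hb : ∀ i, r ≤ b i := by
    intro i
    simp only [b]
    split_ifs
    · exact le_rfl
    · rw [le_div_iff₀ hN']
      linarith [le_pairLevel (hd i.1 i.2)]
  have hbβ : ∀ i, b i ≤ β := by
    intro i
    simp only [b]
    split_ifs
    · linarith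
    · refine le_trans ?_ hβ'
      rw [div_le_iff₀ hN']
      linarith [pairLevel_le (hd i.1 i.2)]
  have hG : ∀ i, v i + lam * dot i.1 i.2 ≤ G := by
    intro i
    simp only [v]
    rw [dot_eq]
    split_ifs with h
    · refine le_max_of_le_right (le_of_eq ?_)
      rw [h, hammingDist_self]
      push_cast
      ring
    · exact le_max_of_le_left (by linarith [le_pairExtreme lam (hd i.1 i.2)])
  let Y : (Config N → ℝ) → ℝ := fun E => ∑ i : Config N × Config N,
    Real.exp (b i * (-(E i.1 + E i.2) - v i))
  have hsplit : ∀ (i : Config N × Config N) (E : Config N → ℝ),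
      Real.exp (b i * (-(E i.1 + E i.2) - v i))
        = Real.exp (-(b i * v i)) * Real.exp (-b i * (E i.1 + E i.2)) := by
    intro i E
    rw [← Real.exp_add]; congr 1; ring
  have hint : ∀ i : Config N × Config N,
      Integrable (fun E => Real.exp (b i * (-(E i.1 + E i.2) - v i))) (disorder N) := by
    intro i
    simp_rw [hsplit]
    exact (integrable_exp_pair _ _ _).const_mul _
  have hval : ∀ i : Config N × Config N,
      ∫ E, Real.exp (b i * (-(E i.1 + E i.2) - v i)) ∂(disorder N)
        = Real.exp (-logPairs N (hammingDist i.1 i.2)) := by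
    intro i
    simp_rw [hsplit]
    rw [integral_const_mul, integral_exp_pair, ← Real.exp_add]
    congr 1
    simp only [b, v]
    split_ifs with h
    · have h0 : logPairs N (hammingDist i.1 i.2) = N * Real.log 2 := by
        rw [h, hammingDist_self, logPairs, Nat.choose_zero_right, Nat.cast_one, mul_one,
          Real.log_pow]
      rw [h0, ← hrr]
      ring
    · have hsq := pairLevel_sq (hd i.1 i.2)
      have : logPairs N (hammingDist i.1 i.2)
          = pairLevel N (hammingDist i.1 i.2) ^ 2 / (2 * N) := by
        rw [hsq]; field_simp
      rw [this]
      field_simp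
      ring
  have hYint : Integrable Y (disorder N) := integrable_finsetSum _ fun i _ => hint i
  have hYval : ∫ E, Y E ∂(disorder N) = N + 1 := by
    rw [← sum_exp_neg_logPairs N, ← Fintype.sum_prod_type', integral_finsetSum _ fun i _ => hint i]
    exact Finset.sum_congr rfl fun i _ => hval i
  -- Jensen's inequality by hand: the logarithm is bounded by its tangent at `N + 2`, the mean of `1
  -- + Y`.
  have hpt : ∀ E : Config N → ℝ, Real.log (partition2 E β lam)
      ≤ β * G + β / r * (Real.log (N + 2) + (N + 2 : ℝ)⁻¹ * (1 + Y E) - 1) := by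
    intro E
    have h := log_sum_exp_le (fun i : Config N × Config N => -(E i.1 + E i.2)) v
      (fun i => lam * dot i.1 i.2) b hr0 hb hbβ hG
    have he : partition2 E β lam
        = ∑ i : Config N × Config N, Real.exp (β * (-(E i.1 + E i.2) + lam * dot i.1 i.2)) := by
      rw [partition2, ← Fintype.sum_prod_type']
      refine Finset.sum_congr rfl fun i _ => ?_
      congr 1
      rw [hamiltonian2]
      ring
    rw [he]
    refine h.trans ?_
    have hY0 : 0 ≤ Y E := Finset.sum_nonneg fun _ _ => (Real.exp_pos _).le
    have hN2 : (0 : ℝ) < N + 2 := by positivity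
    have hβ0 : 0 ≤ β / r := div_nonneg (by linarith) hr0.le
    gcongr
    have h1 := Real.log_le_sub_one_of_pos (x := (N + 2 : ℝ)⁻¹ * (1 + Y E)) (by positivity)
    rw [Real.log_mul (by positivity) (by positivity), Real.log_inv] at h1
    change Real.log (1 + Y E) ≤ _
    linarith
  have hi1 : Integrable (fun E => (N + 2 : ℝ)⁻¹ * (1 + Y E)) (disorder N) :=
    ((integrable_const 1).add hYint).const_mul _
  have hi0 : Integrable (fun E => Real.log (N + 2) + (N + 2 : ℝ)⁻¹ * (1 + Y E)) (disorder N) :=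
    (integrable_const _).add hi1
  have hi2 : Integrable (fun E => Real.log (N + 2) + (N + 2 : ℝ)⁻¹ * (1 + Y E) - 1) (disorder N) :=
    hi0.sub (integrable_const _)
  refine (integral_mono (integrable_log_partition2 N β lam)
    ((integrable_const (β * G)).add (hi2.const_mul (β / r))) hpt).trans (le_of_eq ?_)
  have e1 : ∫ E, (1 + Y E) ∂(disorder N) = N + 2 := by
    rw [integral_add (integrable_const _) hYint, hYval]
    simp
    ring
  have e2 : ∫ E, (Real.log (N + 2) + (N + 2 : ℝ)⁻¹ * (1 + Y E) - 1) ∂(disorder N)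
      = Real.log (N + 2) := by
    rw [integral_sub hi0 (integrable_const _),
      integral_add (integrable_const _) hi1, integral_const_mul, e1,
      inv_mul_cancel₀ (by positivity)]
    simp
  change ∫ E, (β * G + β / r * (Real.log (N + 2) + (N + 2 : ℝ)⁻¹ * (1 + Y E) - 1)) ∂(disorder N) = _
  rw [integral_add (integrable_const _) (hi2.const_mul _), integral_const_mul (β / r), e2]
  simp

/-! ### Second moment of the number of deep pairs -/

/-- The indicator that all energies indexed by `T` lie in `A`. -/
def allMem {N : ℕ} (A : Set ℝ) (T : Finset (Config N)) : (Config N → ℝ) → ℝ :=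
  Set.indicator {E | ∀ x ∈ T, E x ∈ A} 1

theorem measurableSet_allMem {N : ℕ} {A : Set ℝ} (hA : MeasurableSet A) (T : Finset (Config N)) :
    MeasurableSet {E : Config N → ℝ | ∀ x ∈ T, E x ∈ A} := by
  have : {E : Config N → ℝ | ∀ x ∈ T, E x ∈ A} = ⋂ x ∈ T, (fun E : Config N → ℝ => E x) ⁻¹' A := by
    ext E; simp
  rw [this]
  exact Finset.measurableSet_biInter _ fun x _ => measurable_pi_apply x hA

theorem integrable_allMem {N : ℕ} {A : Set ℝ} (hA : MeasurableSet A) (T : Finset (Config N)) :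
    Integrable (allMem A T) (disorder N) :=
  (integrable_const (1 : ℝ)).indicator (measurableSet_allMem hA T)

theorem allMem_mul {N : ℕ} (A : Set ℝ) (T T' : Finset (Config N)) (E : Config N → ℝ) :
    allMem A T E * allMem A T' E = allMem A (T ∪ T') E := by
  have : {E : Config N → ℝ | ∀ x ∈ T ∪ T', E x ∈ A}
      = {E | ∀ x ∈ T, E x ∈ A} ∩ {E | ∀ x ∈ T', E x ∈ A} := by
    ext E
    simp only [Finset.mem_union, Set.mem_inter_iff, Set.mem_ofPred_eq]
    exact ⟨fun h => ⟨fun x hx => h x (Or.inl hx), fun x hx => h x (Or.inr hx)⟩,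
      fun h x hx => hx.elim (h.1 x) (h.2 x)⟩
  rw [allMem, allMem, allMem, this, Set.inter_indicator_one]
  rfl

theorem integral_allMem {N : ℕ} {A : Set ℝ} (hA : MeasurableSet A) (T : Finset (Config N)) :
    ∫ E, allMem A T E ∂(disorder N) = (gaussianReal 0 ((N : NNReal) / 2)).real A ^ T.card := by
  have hset : {E : Config N → ℝ | ∀ x ∈ T, E x ∈ A}
      = Set.univ.pi fun x => if x ∈ T then A else Set.univ := by
    ext E
    simp only [Set.mem_ofPred_eq, Set.mem_pi, Set.mem_univ, true_imp_iff]
    refine forall_congr' fun x => ?_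
    by_cases h : x ∈ T <;> simp [h]
  rw [allMem, integral_indicator_one (measurableSet_allMem hA T), hset, measureReal_def, disorder,
    Measure.pi_pi, ENNReal.toReal_prod]
  have : ∀ x : Config N, ((gaussianReal 0 ((N : NNReal) / 2))
      (if x ∈ T then A else Set.univ)).toReal
      = if x ∈ T then (gaussianReal 0 ((N : NNReal) / 2)).real A else 1 := by
    intro x
    split_ifs
    · rfl
    · simp
  rw [Finset.prod_congr rfl fun x _ => this x, Finset.prod_ite_mem, Finset.univ_inter,
    Finset.prod_const]

/-- Ordered pairs of configurations at Hamming distance `k`. -/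
def pairsAt (N k : ℕ) : Finset (Config N × Config N) :=
  Finset.univ.filter fun i => hammingDist i.1 i.2 = k

theorem mem_pairsAt {N k : ℕ} {i : Config N × Config N} :
    i ∈ pairsAt N k ↔ hammingDist i.1 i.2 = k := by simp [pairsAt]

theorem sum_pairsAt_fst {N k : ℕ} (x : Config N) :
    ∑ j ∈ pairsAt N k, (if j.1 = x then (1 : ℝ) else 0) = N.choose k := by
  rw [Finset.sum_boole, ← card_hammingDist_eq x k]
  congr 1
  refine Finset.card_bij' (fun j _ => j.2) (fun t _ => (x, t)) ?_ ?_ ?_ ?_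
  · rintro ⟨a, b⟩ h
    simp only [Finset.mem_filter, mem_pairsAt] at h
    simp [← h.2, h.1]
  · intro t h
    simpa [mem_pairsAt] using h
  · rintro ⟨a, b⟩ h
    simp only [Finset.mem_filter, mem_pairsAt] at h
    simp [h.2]
  · intro t _
    rfl

theorem sum_pairsAt_swap {N k : ℕ} (f : Config N × Config N → ℝ) :
    ∑ j ∈ pairsAt N k, f j.swap = ∑ j ∈ pairsAt N k, f j := by
  refine Finset.sum_nbij' Prod.swap Prod.swap ?_ ?_ ?_ ?_ ?_
  · intro i h
    rw [mem_pairsAt] at h ⊢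
    rw [← h]
    exact hammingDist_comm _ _
  · intro i h
    rw [mem_pairsAt] at h ⊢
    rw [← h]
    exact hammingDist_comm _ _
  · simp
  · simp
  · simp

theorem sum_pairsAt_snd {N k : ℕ} (x : Config N) :
    ∑ j ∈ pairsAt N k, (if j.2 = x then (1 : ℝ) else 0) = N.choose k := by
  rw [← sum_pairsAt_fst x]
  exact sum_pairsAt_swap fun j => if j.1 = x then (1 : ℝ) else 0

theorem card_pairsAt (N k : ℕ) : ((pairsAt N k).card : ℝ) = 2 ^ N * N.choose k := by
  have h : ∀ j : Config N × Config N, (1 : ℝ) = ∑ x, if j.1 = x then (1 : ℝ) else 0 := by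
    intro j; simp
  rw [Finset.cast_card, Finset.sum_congr rfl fun j _ => h j, Finset.sum_comm]
  simp_rw [sum_pairsAt_fst, Finset.sum_const, Finset.card_univ, card_config, nsmul_eq_mul]
  push_cast
  rfl

/-- By independence, the joint probability for two pairs is `p` to the number of distinct
configurations involved: four if disjoint, three if one is shared, two if the pairs agree up to
order. The indicators are arranged so that summing over `j` only needs `sum_pairsAt_fst` and
`sum_pairsAt_snd`. -/
theorem pow_card_union_le {N : ℕ} {p : ℝ} (hp0 : 0 ≤ p) {i j : Config N × Config N}
    (hi : i.1 ≠ i.2) (hj : j.1 ≠ j.2) :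
    p ^ (({i.1, i.2} : Finset (Config N)) ∪ {j.1, j.2}).card
      ≤ p ^ 4 + p ^ 3 * ((if j.1 = i.1 then 1 else 0) + (if j.1 = i.2 then 1 else 0)
        + (if j.2 = i.1 then 1 else 0) + (if j.2 = i.2 then 1 else 0))
        + p ^ 2 * ((if j = i then 1 else 0) + if j = i.swap then 1 else 0) := by
  obtain ⟨a, b⟩ := i
  obtain ⟨c, d⟩ := j
  simp only at hi hj
  simp only [Prod.swap_prod_mk, Prod.mk.injEq]
  have h2 : 0 ≤ p ^ 2 := by positivity
  have h3 : 0 ≤ p ^ 3 := by positivity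
  have h4 : 0 ≤ p ^ 4 := by positivity
  by_cases h1 : c = a
  · subst h1
    by_cases hdb : d = b
    · subst hdb
      simp [hj, hj.symm]
      nlinarith
    · have : (({c, b} : Finset (Config N)) ∪ {c, d}).card = 3 := by
        rw [show ({c, b} : Finset (Config N)) ∪ {c, d} = {c, b, d} by ext; simp]
        exact Finset.card_eq_three.2 ⟨c, b, d, hi, hj, fun h => hdb h.symm, rfl⟩
      rw [this]
      simp [hi, hj.symm, hdb]
      nlinarith
  · by_cases hcb : c = b
    · subst hcb
      by_cases hda : d = a
      · subst hda
        have : (({d, c} : Finset (Config N)) ∪ {c, d}).card = 2 := by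
          rw [show ({d, c} : Finset (Config N)) ∪ {c, d} = {c, d} by ext; simp]
          exact Finset.card_pair hj
        rw [this]
        simp [hi, hj]
        nlinarith
      · have : (({a, c} : Finset (Config N)) ∪ {c, d}).card = 3 := by
          rw [show ({a, c} : Finset (Config N)) ∪ {c, d} = {a, c, d} by ext; simp]
          exact Finset.card_eq_three.2 ⟨a, c, d, hi, fun h => hda h.symm, hj, rfl⟩
        rw [this]
        simp [h1, hj.symm, hda]
        nlinarith
    · by_cases hda : d = a
      · subst hda
        have : (({d, b} : Finset (Config N)) ∪ {c, d}).card = 3 := by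
          rw [show ({d, b} : Finset (Config N)) ∪ {c, d} = {d, b, c} by ext; simp; tauto]
          exact Finset.card_eq_three.2 ⟨d, b, c, hi, hj.symm, fun h => hcb h.symm, rfl⟩
        rw [this]
        simp [hi, h1, hcb]
        nlinarith
      · by_cases hdb : d = b
        · subst hdb
          have : (({a, d} : Finset (Config N)) ∪ {c, d}).card = 3 := by
            rw [show ({a, d} : Finset (Config N)) ∪ {c, d} = {a, d, c} by ext; simp; tauto]
            exact Finset.card_eq_three.2 ⟨a, d, c, hi, fun h => h1 h.symm, hj.symm, rfl⟩
          rw [this]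
          simp [h1, hcb, hda]
          nlinarith
        · have : (({a, b} : Finset (Config N)) ∪ {c, d}).card = 4 := by
            rw [Finset.card_union_of_disjoint, Finset.card_pair hi, Finset.card_pair hj]
            rw [Finset.disjoint_left]
            intro x hx hx'
            simp only [Finset.mem_insert, Finset.mem_singleton] at hx hx'
            grind
          rw [this]
          simp [h1, hcb, hda, hdb]

/-- Second-moment bound on the probability that no pair at distance `k` has both energies
in `A`. -/
theorem prob_no_pair_le {N k : ℕ} (hk0 : 0 < k) (hk : k ≤ N) {A : Set ℝ} (hA : MeasurableSet A)
    {p : ℝ} (hpA : (gaussianReal 0 ((N : NNReal) / 2)).real A = p) (hp : 0 < p) :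
    (disorder N).real {E | ∀ i ∈ pairsAt N k, ¬ (E i.1 ∈ A ∧ E i.2 ∈ A)}
      ≤ 4 / (2 ^ N * p) + 2 / (2 ^ N * N.choose k * p ^ 2) := by
  set B : Set (Config N → ℝ) := {E | ∀ i ∈ pairsAt N k, ¬ (E i.1 ∈ A ∧ E i.2 ∈ A)} with hB
  let T : Config N × Config N → Finset (Config N) := fun i => {i.1, i.2}
  let W : (Config N → ℝ) → ℝ := fun E => ∑ i ∈ pairsAt N k, allMem A (T i) E
  have hne : ∀ i ∈ pairsAt N k, i.1 ≠ i.2 := by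
    intro i hi h
    rw [mem_pairsAt, h, hammingDist_self] at hi
    omega
  have hC : (0 : ℝ) < N.choose k := by exact_mod_cast Nat.choose_pos hk
  set M : ℝ := 2 ^ N * N.choose k with hM
  have hM0 : 0 < M := by positivity
  have hcard : ((pairsAt N k).card : ℝ) = M := card_pairsAt N k
  have hWint : Integrable W (disorder N) := integrable_finsetSum _ fun i _ => integrable_allMem hA _
  have hW1 : ∫ E, W E ∂(disorder N) = M * p ^ 2 := by
    rw [integral_finsetSum _ fun i _ => integrable_allMem hA _]
    rw [Finset.sum_congr rfl (g := fun _ => p ^ 2), Finset.sum_const, nsmul_eq_mul, hcard]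
    intro i hi
    rw [integral_allMem hA, hpA, Finset.card_pair (hne i hi)]
  have hWsq : ∀ E, W E ^ 2 = ∑ i ∈ pairsAt N k, ∑ j ∈ pairsAt N k, allMem A (T i ∪ T j) E := by
    intro E
    simp only [W]
    rw [sq, Finset.sum_mul_sum]
    simp_rw [allMem_mul]
  have hint2 : Integrable (fun E => W E ^ 2) (disorder N) := by
    simp_rw [hWsq]
    exact integrable_finsetSum _ fun i _ => integrable_finsetSum _ fun j _ => integrable_allMem hA _
  -- For fixed `i`, at most `4 * N.choose k` coincidences of one configuration and two of the whole
  -- pair are counted; the `p ^ 4` part reproduces the squared mean.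
  have hW2 : ∫ E, W E ^ 2 ∂(disorder N) ≤ M * (M * p ^ 4 + 4 * N.choose k * p ^ 3 + 2 * p ^ 2) := by
    simp_rw [hWsq]
    rw [integral_finsetSum _ fun i _ => integrable_finsetSum _ fun j _ => integrable_allMem hA _,
      ← hcard, ← nsmul_eq_mul, hcard]
    refine Finset.sum_le_card_nsmul _ _ _ fun i hi => ?_
    rw [integral_finsetSum _ fun j _ => integrable_allMem hA _]
    calc ∑ j ∈ pairsAt N k, ∫ E, allMem A (T i ∪ T j) E ∂(disorder N)
        ≤ ∑ j ∈ pairsAt N k, (p ^ 4 + p ^ 3 * ((if j.1 = i.1 then 1 else 0)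
          + (if j.1 = i.2 then 1 else 0) + (if j.2 = i.1 then 1 else 0)
          + (if j.2 = i.2 then 1 else 0))
          + p ^ 2 * ((if j = i then 1 else 0) + if j = i.swap then 1 else 0)) := by
          refine Finset.sum_le_sum fun j hj => ?_
          rw [integral_allMem hA, hpA]
          exact pow_card_union_le hp.le (hne i hi) (hne j hj)
      _ ≤ M * p ^ 4 + 4 * N.choose k * p ^ 3 + 2 * p ^ 2 := by
          simp only [Finset.sum_add_distrib, ← Finset.mul_sum, sum_pairsAt_fst, sum_pairsAt_snd,
            Finset.sum_const, nsmul_eq_mul, hcard]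
          have h1 : ∀ x : Config N × Config N,
              ∑ j ∈ pairsAt N k, (if j = x then (1 : ℝ) else 0) ≤ 1 := by
            intro x
            rw [Finset.sum_ite_eq']
            split_ifs <;> norm_num
          nlinarith [h1 i, h1 i.swap, show 0 < p ^ 2 by positivity]
  have hBm : MeasurableSet B := by
    have : B = ⋂ i ∈ pairsAt N k, {E | ∀ x ∈ T i, E x ∈ A}ᶜ := by
      ext E; simp [hB, T]
    rw [this]
    exact Finset.measurableSet_biInter _ fun i _ => (measurableSet_allMem hA _).compl
  have hdev₀ : Integrable (fun E => W E ^ 2 - 2 * (M * p ^ 2) * W E) (disorder N) :=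
    hint2.sub (hWint.const_mul _)
  have hdev : Integrable (fun E => W E ^ 2 - 2 * (M * p ^ 2) * W E + (M * p ^ 2) ^ 2)
      (disorder N) := hdev₀.add (integrable_const _)
  -- Chebyshev: on `B` the count `W` vanishes, so its squared deviation is the squared mean.
  have hcheb : (M * p ^ 2) ^ 2 * (disorder N).real B
      ≤ ∫ E, (W E ^ 2 - 2 * (M * p ^ 2) * W E + (M * p ^ 2) ^ 2) ∂(disorder N) := by
    rw [← integral_indicator_one hBm, ← integral_const_mul]
    refine integral_mono (((integrable_const (1 : ℝ)).indicator hBm).const_mul _) hdev fun E => ?_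
    by_cases hE : E ∈ B
    · have : W E = 0 := by
        refine Finset.sum_eq_zero fun i hi => Set.indicator_of_notMem ?_ _
        have := hE i hi
        simpa [T] using this
      simp [hE, this]
    · simp only [hE, not_false_eq_true, Set.indicator_of_notMem, mul_zero]
      nlinarith [sq_nonneg (W E - M * p ^ 2)]
  have hval : ∫ E, (W E ^ 2 - 2 * (M * p ^ 2) * W E + (M * p ^ 2) ^ 2) ∂(disorder N)
      = ∫ E, W E ^ 2 ∂(disorder N) - (M * p ^ 2) ^ 2 := by
    rw [integral_add hdev₀ (integrable_const _),
      integral_sub hint2 (hWint.const_mul _), integral_const_mul, hW1]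
    simp
    ring
  have hfin : (M * p ^ 2) ^ 2 * (disorder N).real B ≤ M * (4 * N.choose k * p ^ 3 + 2 * p ^ 2) := by
    nlinarith
  have hpos : 0 < (M * p ^ 2) ^ 2 := by positivity
  rw [← le_div_iff₀' hpos] at hfin
  refine hfin.trans (le_of_eq ?_)
  rw [hM]
  field_simp

/-! ### Lower bound: existence of pairs near the extreme level -/

/-- Lower bound on the Gaussian tail of variance `N / 2`. -/
theorem le_gaussianReal_Iic {N : ℕ} (hN : 0 < N) {a h : ℝ} (ha : 0 ≤ a) (hh : 0 ≤ h) :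
    h / Real.sqrt (Real.pi * N) * Real.exp (-(a + h) ^ 2 / N)
      ≤ (gaussianReal 0 ((N : NNReal) / 2)).real (Set.Iic (-a)) := by
  have hv : (N : NNReal) / 2 ≠ 0 := by positivity
  have hN' : (0 : ℝ) < N := by positivity
  -- Only the interval of length `h` next to `-a` is kept, with the density bounded below by its
  -- value at the far end.
  calc h / Real.sqrt (Real.pi * N) * Real.exp (-(a + h) ^ 2 / N)
      = (Real.sqrt (Real.pi * N))⁻¹ * Real.exp (-(a + h) ^ 2 / N)
        * volume.real (Set.Icc (-(a + h)) (-a)) := by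
        rw [Real.volume_real_Icc_of_le (by linarith)]
        ring
    _ ≤ ∫ x in Set.Icc (-(a + h)) (-a), gaussianPDFReal 0 ((N : NNReal) / 2) x := by
        refine setIntegral_ge_of_const_le_real measurableSet_Icc (by simp) (fun x hx => ?_)
          (integrable_gaussianPDFReal _ _).integrableOn
        have e : (2 * Real.pi * ((N : NNReal) / 2 : NNReal)) = Real.pi * N := by push_cast; ring
        have e' : (2 * (((N : NNReal) / 2 : NNReal) : ℝ)) = N := by push_cast; ring
        rw [gaussianPDFReal_def]
        simp only
        rw [e, e', sub_zero]
        gcongr ?_ * Real.exp (-?_ / _)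
        exact sq_le_sq' (by linarith [hx.1, hx.2]) (by linarith [hx.1, hx.2])
    _ = (gaussianReal 0 ((N : NNReal) / 2)).real (Set.Icc (-(a + h)) (-a)) := by
        rw [measureReal_def, gaussianReal_apply_eq_integral _ hv, ENNReal.toReal_ofReal]
        exact integral_nonneg fun x => gaussianPDFReal_nonneg _ _ _
    _ ≤ _ := measureReal_mono Set.Icc_subset_Iic_self

/-- This gives `ρ > 2 / 5` below; with `δ ≤ 1 / 8` the threshold `ρ - 2 δ` is then positive and `2 ρ
δ - δ ^ 2 ≥ δ / 2`. -/
theorem four_fifths_lt_sqrt_log_two : 4 / 5 < Real.sqrt (Real.log 2) := by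
  refine Real.lt_sqrt_of_sq_lt ?_
  have := Real.log_two_gt_d9
  norm_num
  linarith

/-- Each energy is asked for half the level, less `2 δ N`. One `δ N` is the width of the Gaussian
tail interval, and `π ≤ δ ^ 2 N` makes its prefactor at least `1`; the other makes both
second-moment denominators exponentially large. For `2 ^ N * p` this needs `ρ ^ 2 ≤ log 2`; for the
pair count, `logPairs N k = 2 N ρ ^ 2`. -/
theorem prob_no_deep_pair_le {N k : ℕ} (hk0 : 0 < k) (hk : k ≤ N) {δ : ℝ} (hδ : 0 < δ)
    (hδ' : δ ≤ 1 / 8) (hN : Real.pi ≤ δ ^ 2 * N) :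
    (disorder N).real {E | ∀ i ∈ pairsAt N k,
      ¬ (E i.1 ∈ Set.Iic (-(pairLevel N k / 2 - 2 * δ * N))
        ∧ E i.2 ∈ Set.Iic (-(pairLevel N k / 2 - 2 * δ * N)))}
      ≤ 6 * Real.exp (-(N * δ / 2)) := by
  have hN0 : 0 < N := hk0.trans_le hk
  have hN' : (0 : ℝ) < N := by positivity
  set ρ := pairLevel N k / (2 * N) with hρ
  have hlev : pairLevel N k = 2 * N * ρ := by rw [hρ]; field_simp
  have hs := four_fifths_lt_sqrt_log_two
  have hρ1 : 2 / 5 < ρ := by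
    have := le_pairLevel hk
    rw [hlev] at this
    nlinarith
  have hρ2 : ρ ≤ Real.sqrt (Real.log 2) := by
    have := pairLevel_le hk
    rw [hlev] at this
    nlinarith
  have hρsq : ρ ^ 2 ≤ Real.log 2 := by
    rw [← Real.sq_sqrt (show 0 ≤ Real.log 2 by positivity)]
    gcongr
  have ha : pairLevel N k / 2 - 2 * δ * N = N * (ρ - 2 * δ) := by rw [hlev]; ring
  rw [ha]
  set A := Set.Iic (-(N * (ρ - 2 * δ)))
  set p := (gaussianReal 0 ((N : NNReal) / 2)).real A with hp
  have hple : Real.exp (-(N * (ρ - δ) ^ 2)) ≤ p := by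
    have h := le_gaussianReal_Iic hN0 (a := N * (ρ - 2 * δ)) (h := N * δ)
      (mul_nonneg hN'.le (by linarith)) (by positivity)
    have h1 : 1 ≤ N * δ / Real.sqrt (Real.pi * N) := by
      rw [one_le_div (Real.sqrt_pos.2 (mul_pos Real.pi_pos hN'))]
      refine Real.sqrt_le_iff.2 ⟨by positivity, ?_⟩
      nlinarith
    have h2 : -(N * (ρ - 2 * δ) + N * δ) ^ 2 / N = -(N * (ρ - δ) ^ 2) := by
      field_simp
      ring
    rw [h2] at h
    exact le_trans (le_mul_of_one_le_left (Real.exp_pos _).le h1) h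
  have hp0 : 0 < p := (Real.exp_pos _).trans_le hple
  refine (prob_no_pair_le hk0 hk measurableSet_Iic hp.symm hp0).trans ?_
  have hNδ : 0 < N * δ := by positivity
  have b1 : Real.exp (N * δ / 2) ≤ 2 ^ N * p := by
    calc Real.exp (N * δ / 2) ≤ Real.exp (N * Real.log 2) * Real.exp (-(N * (ρ - δ) ^ 2)) := by
          rw [← Real.exp_add, Real.exp_le_exp]
          nlinarith
      _ ≤ 2 ^ N * p := by
          rw [mul_comm (N : ℝ), Real.exp_mul, Real.exp_log (by norm_num), Real.rpow_natCast]
          gcongr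
  have b2 : Real.exp (N * δ / 2) ≤ 2 ^ N * N.choose k * p ^ 2 := by
    have hlp : logPairs N k = 2 * N * ρ ^ 2 := by
      have := pairLevel_sq hk
      rw [hlev] at this
      have h2 : (2 * N : ℝ) * (logPairs N k - 2 * N * ρ ^ 2) = 0 := by linarith
      have := (mul_eq_zero.1 h2).resolve_left (by positivity)
      linarith
    calc Real.exp (N * δ / 2) ≤ Real.exp (logPairs N k) * Real.exp (-(N * (ρ - δ) ^ 2)) ^ 2 := by
          rw [← Real.exp_nat_mul, ← Real.exp_add, Real.exp_le_exp, hlp]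
          push_cast
          nlinarith
      _ ≤ 2 ^ N * N.choose k * p ^ 2 := by
          rw [exp_logPairs hk]
          gcongr
  have hE := Real.exp_pos (N * δ / 2)
  calc 4 / (2 ^ N * p) + 2 / (2 ^ N * N.choose k * p ^ 2)
      ≤ 4 / Real.exp (N * δ / 2) + 2 / Real.exp (N * δ / 2) := by gcongr
    _ = _ := by rw [Real.exp_neg]; ring

/-- Any functional dominating `-(E_s + E_t)` on the pairs at distance `k` has mean at least
about `pairLevel N k`. -/
theorem le_integral_of_pairs_le {N k : ℕ} (hk0 : 0 < k) (hk : k ≤ N) {δ : ℝ} (hδ : 0 < δ)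
    (hδ' : δ ≤ 1 / 8) (hN : Real.pi ≤ δ ^ 2 * N) {F : (Config N → ℝ) → ℝ}
    (hF : Integrable F (disorder N))
    (hle : ∀ E s t, hammingDist s t = k → -(E s + E t) ≤ F E) :
    (pairLevel N k - 4 * δ * N) * (1 - 6 * Real.exp (-(N * δ / 2))) - 2 * Real.sqrt N
      ≤ ∫ E, F E ∂(disorder N) := by
  have hN0 : 0 < N := hk0.trans_le hk
  have hN' : (0 : ℝ) < N := by positivity
  set a := pairLevel N k / 2 - 2 * δ * N with ha
  set A := Set.Iic (-a)
  set B : Set (Config N → ℝ) := {E | ∀ i ∈ pairsAt N k, ¬ (E i.1 ∈ A ∧ E i.2 ∈ A)} with hB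
  have hBp : (disorder N).real B ≤ 6 * Real.exp (-(N * δ / 2)) :=
    prob_no_deep_pair_le hk0 hk hδ hδ' hN
  have ha0 : 0 ≤ a := by
    have := le_pairLevel hk
    nlinarith [four_fifths_lt_sqrt_log_two]
  have hBm : MeasurableSet B := by
    have : B = ⋂ i ∈ pairsAt N k,
        ({E : Config N → ℝ | E i.1 ∈ A} ∩ {E : Config N → ℝ | E i.2 ∈ A})ᶜ := by
      ext E; simp [hB]
    rw [this]
    exact Finset.measurableSet_biInter _ fun i _ =>
      ((measurable_pi_apply i.1 measurableSet_Iic).inter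
        (measurable_pi_apply i.2 measurableSet_Iic)).compl
  -- A fixed pair at distance `k` bounds `F` below even on the exceptional event `B`, at a cost of
  -- order `√N` in the mean.
  obtain ⟨t₀, ht₀⟩ : ∃ t : Config N, hammingDist 1 t = k := by
    have h := card_hammingDist_eq (1 : Config N) k
    have h' : 0 < (Finset.univ.filter fun t : Config N => hammingDist 1 t = k).card :=
      h ▸ Nat.choose_pos hk
    obtain ⟨t, ht⟩ := Finset.card_pos.1 h'
    exact ⟨t, (Finset.mem_filter.1 ht).2⟩
  have hi1 : Integrable (B.indicator (1 : (Config N → ℝ) → ℝ)) (disorder N) :=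
    (integrable_const (1 : ℝ)).indicator hBm
  have hi2 : Integrable (fun E => 2 * a - 2 * a * B.indicator 1 E) (disorder N) :=
    (integrable_const _).sub (hi1.const_mul _)
  have hi3 : Integrable (fun E : Config N → ℝ => |E 1| + |E t₀|) (disorder N) :=
    (integrable_eval 1).abs.add (integrable_eval t₀).abs
  have hpt : ∀ E, 2 * a - 2 * a * B.indicator 1 E - (|E 1| + |E t₀|) ≤ F E := by
    intro E
    by_cases hE : E ∈ B
    · simp only [hE, Set.indicator_of_mem, Pi.one_apply]
      linarith [hle E 1 t₀ ht₀, le_abs_self (E 1), le_abs_self (E t₀)]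
    · simp only [hE, not_false_eq_true, Set.indicator_of_notMem]
      have : ∃ i ∈ pairsAt N k, E i.1 ∈ A ∧ E i.2 ∈ A := by
        by_contra hcon
        exact hE fun i hi hi' => hcon ⟨i, hi, hi'⟩
      obtain ⟨i, hi, h1, h2⟩ := this
      have h1 : E i.1 ≤ -a := h1
      have h2 : E i.2 ≤ -a := h2
      linarith [hle E i.1 i.2 (mem_pairsAt.1 hi), abs_nonneg (E 1), abs_nonneg (E t₀)]
  refine le_trans ?_ (integral_mono (hi2.sub hi3) hF hpt)
  change _ ≤ ∫ E, (2 * a - 2 * a * B.indicator 1 E - (|E 1| + |E t₀|)) ∂(disorder N)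
  rw [integral_sub hi2 hi3, integral_sub (integrable_const _) (hi1.const_mul _),
    integral_const_mul (2 * a) (B.indicator 1), integral_indicator_one hBm, integral_add (integrable_eval 1).abs (integrable_eval t₀).abs]
  have h1 := integral_abs_eval_le hN0 (1 : Config N)
  have h2 := integral_abs_eval_le hN0 t₀
  have h3 : pairLevel N k - 4 * δ * N = 2 * a := by rw [ha]; ring
  rw [h3]
  simp only [integral_const, probReal_univ, one_smul]
  nlinarith [mul_le_mul_of_nonneg_left hBp ha0]

/-! ### Convergence of the free energy -/

/-- The averaged pressure per spin, divided by `β`. -/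
theorem neg_freeEnergy2N (N : ℕ) (β lam : ℝ) :
    -freeEnergy2N N β lam = (∫ E, Real.log (partition2 E β lam) ∂(disorder N)) / (β * N) := by
  rw [freeEnergy2N]; ring

/-- The second entry of the maximum is the diagonal contribution: averaging the terms `(s, s)` and
`(t, t)` of a deep pair gives the energy `E s + E t` with full overlap `N`. No separate estimate for
single energies is needed. -/
theorem le_neg_freeEnergy2N_pairs {N k : ℕ} (hk0 : 0 < k) (hk : k ≤ N) {β δ : ℝ} (hβ : 0 < β)
    (hδ : 0 < δ) (hδ' : δ ≤ 1 / 8) (hN : Real.pi ≤ δ ^ 2 * N) (lam : ℝ) :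
    (pairLevel N k / N - 4 * δ) * (1 - 6 * Real.exp (-(N * δ / 2))) - 2 * (Real.sqrt N / N)
      + max (lam * (N - 2 * k) / N) lam ≤ -freeEnergy2N N β lam := by
  have hN' : (0 : ℝ) < N := by
    have := hk0.trans_le hk
    positivity
  have main : ∀ c : ℝ, (∀ (E : Config N → ℝ) (s t : Config N), hammingDist s t = k →
      β * (-(E s + E t) + c * N) ≤ Real.log (partition2 E β lam)) →
      (pairLevel N k / N - 4 * δ) * (1 - 6 * Real.exp (-(N * δ / 2))) - 2 * (Real.sqrt N / N)
      + c ≤ -freeEnergy2N N β lam := by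
    intro c hc
    have hi := (integrable_log_partition2 N β lam).div_const β
    have h := le_integral_of_pairs_le hk0 hk hδ hδ' hN
      (F := fun E => Real.log (partition2 E β lam) / β - c * N) (hi.sub (integrable_const _))
      (fun E s t hst => by
        have := hc E s t hst
        rw [le_sub_iff_add_le, le_div_iff₀ hβ]
        linarith)
    rw [integral_sub hi (integrable_const _), integral_div] at h
    simp only [integral_const, probReal_univ, one_smul] at h
    rw [neg_freeEnergy2N, ← div_div, le_div_iff₀ hN']
    refine le_trans (le_of_eq ?_) (le_sub_iff_add_le.1 h)
    field_simp
  rw [← max_add_add_left]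
  refine max_le (main _ fun E s t hst => ?_) (main _ fun E s t _ => ?_)
  · refine le_trans (le_of_eq ?_) (le_log_partition2 E β lam s t)
    rw [hamiltonian2, dot_eq, hst]
    field_simp
    ring
  · have hd : ∀ s : Config N, dot s s = N := fun s => by rw [dot_eq, hammingDist_self]; simp
    have h1 := le_log_partition2 E β lam s s
    have h2 := le_log_partition2 E β lam t t
    rw [hamiltonian2, hd] at h1 h2
    linarith

theorem tendsto_freeEnergy2N {β : ℝ} (hβ : betaC ≤ β) (lam : ℝ) :
    Tendsto (fun N => freeEnergy2N N β lam) atTop (𝓝 (-extreme lam)) := by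
  have hs := four_fifths_lt_sqrt_log_two
  have hβ0 : 0 < β := lt_of_lt_of_le (by unfold betaC; linarith) hβ
  suffices h : Tendsto (fun N => -freeEnergy2N N β lam) atTop (𝓝 (extreme lam)) by
    simpa using h.neg
  have hlog : Tendsto (fun N : ℕ => Real.log ((N : ℝ) + 2) / N) atTop (𝓝 0) := by
    have h := (Real.isLittleO_log_id_atTop.tendsto_div_nhds_zero.comp
      (tendsto_natCast_atTop_atTop.comp (tendsto_add_atTop_nat 2)))
    have h' : Tendsto (fun N : ℕ => 1 + 2 * ((N : ℝ))⁻¹) atTop (𝓝 (1 + 2 * 0)) :=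
      ((tendsto_inv_atTop_nhds_zero_nat (𝕜 := ℝ)).const_mul 2).const_add 1
    have := h.mul h'
    rw [zero_mul] at this
    refine this.congr' ?_
    filter_upwards [eventually_gt_atTop 0] with N hN
    have : (N : ℝ) ≠ 0 := by positivity
    have : (N : ℝ) + 2 ≠ 0 := by positivity
    simp only [Function.comp, id, Nat.cast_add, Nat.cast_ofNat]
    field_simp
  have hsqrt : Tendsto (fun N : ℕ => Real.sqrt N / N) atTop (𝓝 0) := by
    have := (tendsto_inv_atTop_zero.comp Real.tendsto_sqrt_atTop).comp
      (tendsto_natCast_atTop_atTop (R := ℝ))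
    refine this.congr fun N => ?_
    simp [Real.sqrt_div_self]
  have hupper : Tendsto (fun N : ℕ => max (pairExtreme lam N / N) (2 * Real.sqrt (Real.log 2) + lam)
      + (Real.sqrt (Real.log 2))⁻¹ * (Real.log ((N : ℝ) + 2) / N)) atTop (𝓝 (extreme lam)) := by
    have := ((tendsto_pairExtreme lam).max (tendsto_const_nhds (x := 2 * Real.sqrt (Real.log 2) + lam))).add
      (hlog.const_mul (Real.sqrt (Real.log 2))⁻¹)
    rw [mul_zero, add_zero] at this
    exact this
  rw [tendsto_order]
  constructor
  · intro c hc
    obtain ⟨δ, hδ, hδ', hcδ⟩ : ∃ δ : ℝ, 0 < δ ∧ δ ≤ 1 / 8 ∧ c < extreme lam - 4 * δ := by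
      refine ⟨min (1 / 8) ((extreme lam - c) / 8), by
        refine lt_min (by norm_num) ?_
        linarith, min_le_left _ _, ?_⟩
      have := min_le_right (1 / 8 : ℝ) ((extreme lam - c) / 8)
      linarith
    have hexp : Tendsto (fun N : ℕ => Real.exp (-(N * δ / 2))) atTop (𝓝 0) := by
      refine Real.tendsto_exp_neg_atTop_nhds_zero.comp ?_
      exact ((tendsto_natCast_atTop_atTop).atTop_mul_const hδ).atTop_div_const (by norm_num)
    have herr : Tendsto (fun N : ℕ => 12 * Real.sqrt (Real.log 2) * Real.exp (-(N * δ / 2))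
        + 2 * (Real.sqrt N / N)) atTop (𝓝 0) := by
      have := (hexp.const_mul (12 * Real.sqrt (Real.log 2))).add (hsqrt.const_mul 2)
      simpa using this
    have hlow : Tendsto (fun N : ℕ => max (pairExtreme lam N / N) (pairLevel N (N - N / 2) / N + lam)
        - 4 * δ - (12 * Real.sqrt (Real.log 2) * Real.exp (-(N * δ / 2))
        + 2 * (Real.sqrt N / N))) atTop (𝓝 (extreme lam - 4 * δ)) := by
      have := (((tendsto_pairExtreme lam).max (tendsto_pairLevel_middle.add_const lam)).sub_const
        (4 * δ)).sub herr
      rw [sub_zero] at this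
      exact this
    have hbig : ∀ᶠ N : ℕ in atTop, Real.pi ≤ δ ^ 2 * N :=
      ((tendsto_natCast_atTop_atTop).const_mul_atTop (by positivity : 0 < δ ^ 2)).eventually_ge_atTop
        _
    filter_upwards [hlow.eventually (lt_mem_nhds hcδ), hbig, eventually_gt_atTop 0] with N h1 h2 hN
    refine h1.trans_le ?_
    have hN' : (0 : ℝ) < N := by positivity
    have hpair : ∀ k, 0 < k → k ≤ N → pairLevel N k / N + max (lam * (N - 2 * k) / N) lam
        - 4 * δ - (12 * Real.sqrt (Real.log 2) * Real.exp (-(N * δ / 2))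
        + 2 * (Real.sqrt N / N)) ≤ -freeEnergy2N N β lam := by
      intro k hk0 hk
      refine le_trans ?_ (le_neg_freeEnergy2N_pairs hk0 hk hβ0 hδ hδ' h2 lam)
      have hle : pairLevel N k / N ≤ 2 * Real.sqrt (Real.log 2) := by
        rw [div_le_iff₀ hN']
        linarith [pairLevel_le hk]
      have hx : (pairLevel N k / N - 4 * δ) * Real.exp (-(N * δ / 2))
          ≤ 2 * Real.sqrt (Real.log 2) * Real.exp (-(N * δ / 2)) := by
        gcongr
        linarith
      linarith
    -- The diagonal branch of `extreme` is recovered from the middle distance, where the level is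
    -- asymptotically `2 √(log 2)` per spin.
    have hmid := hpair (N - N / 2) (by omega) (Nat.sub_le _ _)
    have hmid' : pairLevel N (N - N / 2) / N + lam - 4 * δ
        - (12 * Real.sqrt (Real.log 2) * Real.exp (-(N * δ / 2)) + 2 * (Real.sqrt N / N))
        ≤ -freeEnergy2N N β lam := by
      refine le_trans ?_ hmid
      have := le_max_right (lam * (N - 2 * ((N - N / 2 : ℕ) : ℝ)) / N) lam
      linarith
    rw [sub_sub, sub_le_iff_le_add]
    refine max_le ?_ (by linarith)
    obtain ⟨k, hk, hkeq⟩ := exists_pairExtreme_eq lam N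
    have hdiv : pairExtreme lam N / N = pairLevel N k / N + lam * (N - 2 * k) / N := by
      rw [hkeq]; ring
    -- The second-moment bound excludes `k = 0`. There the level equals the one at `k = N` and the
    -- overlap term is `lam`, so the diagonal contribution at distance `N` suffices.
    rcases Nat.eq_zero_or_pos k with rfl | hk0
    · have h3 := hpair N hN le_rfl
      have h4 := le_max_right (lam * (N - 2 * (N : ℝ)) / N) lam
      have h5 : pairLevel N 0 = pairLevel N N := by simp [pairLevel, logPairs]
      have h6 : lam * (N - 2 * ((0 : ℕ) : ℝ)) / N = lam := by
        rw [Nat.cast_zero, mul_zero, sub_zero]; field_simp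
      rw [hdiv, h5, h6]
      linarith
    · have h3 := hpair k hk0 hk
      have h4 := le_max_left (lam * (N - 2 * (k : ℝ)) / N) lam
      linarith
  · intro c hc
    filter_upwards [hupper.eventually (gt_mem_nhds hc), eventually_gt_atTop 0] with N h1 hN
    refine lt_of_le_of_lt ?_ h1
    have hN' : (0 : ℝ) < N := by positivity
    have h2 := integral_log_partition2_le hN hβ lam
    rw [neg_freeEnergy2N, div_le_iff₀ (by positivity)]
    refine h2.trans (le_of_eq ?_)
    have h3 : max (pairExtreme lam N / N) (2 * Real.sqrt (Real.log 2) + lam) * N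
        = max (pairExtreme lam N) (N * (2 * Real.sqrt (Real.log 2) + lam)) := by
      rw [max_mul_of_nonneg _ _ hN'.le]
      congr 1
      · field_simp
      · ring
    rw [← h3]
    field_simp

end

end REM

/-! ### One-sided derivatives at zero coupling -/

namespace REM

theorem freeEnergy2_eq {β : ℝ} (hβ : betaC ≤ β) : freeEnergy2 β = fun lam => -extreme lam :=
  funext fun lam => (tendsto_freeEnergy2N hβ lam).limUnder_eq

theorem hasDerivAt_neg_extreme {x : ℝ} (hx : 0 < x) :
    HasDerivAt (fun lam => -extreme lam) (-1) x := by
  have h : HasDerivAt (fun lam => -(2 * Real.sqrt (Real.log 2) + lam)) (-1) x :=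
    ((hasDerivAt_id x).const_add _).neg
  refine h.congr_of_eventuallyEq ?_
  filter_upwards [lt_mem_nhds hx] with y hy
  rw [extreme_of_nonneg hy.le]

theorem hasDerivWithinAt_neg_extreme_zero :
    HasDerivWithinAt (fun lam => -extreme lam) (-1) (Set.Ioi 0) 0 := by
  have h : HasDerivWithinAt (fun lam => -(2 * Real.sqrt (Real.log 2) + lam)) (-1) (Set.Ioi 0)
      (0 : ℝ) := (((hasDerivAt_id (0 : ℝ)).const_add _).neg).hasDerivWithinAt
  refine h.congr (fun y hy => ?_) ?_
  · rw [extreme_of_nonneg (le_of_lt hy)]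
  · rw [extreme_of_nonneg le_rfl]

theorem tendsto_deriv_downToZero :
    Tendsto (deriv fun lam => -extreme lam) (downToZero fun lam => -extreme lam) (𝓝 (-1)) := by
  refine tendsto_const_nhds.congr' ?_
  filter_upwards [self_mem_nhdsWithin] with x hx
  exact (hasDerivAt_neg_extreme hx.1).deriv.symm

theorem derivLimDown_neg_extreme : derivLimDown (fun lam => -extreme lam) = -1 := by
  have hset : {x : ℝ | 0 < x ∧ DifferentiableAt ℝ (fun lam => -extreme lam) x} = Set.Ioi 0 := by
    ext x
    exact ⟨fun h => h.1, fun h => ⟨h, (hasDerivAt_neg_extreme h).differentiableAt⟩⟩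
  have : (downToZero fun lam => -extreme lam).NeBot := by
    rw [downToZero, hset]
    infer_instance
  exact tendsto_deriv_downToZero.limUnder_eq

theorem countable_not_differentiableAt_neg_extreme :
    {lam : ℝ | ¬ DifferentiableAt ℝ (fun lam => -extreme lam) lam}.Countable := by
  simpa only [differentiableAt_fun_neg_iff] using convexOn_extreme.countable_not_differentiableAt

theorem tendsto_deriv_upToZero :
    Tendsto (deriv fun lam => -extreme lam) (upToZero fun lam => -extreme lam)
      (𝓝 (-derivWithin extreme (Set.Iio 0) 0)) := by
  have h := (convexOn_extreme.tendsto_deriv_leftDeriv 0).neg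
  rw [upToZero]
  simp only [differentiableAt_fun_neg_iff]
  refine h.congr fun x => ?_
  exact (deriv.fun_neg (f := extreme) (x := x)).symm

theorem derivLimUp_neg_extreme :
    derivLimUp (fun lam => -extreme lam) = -derivWithin extreme (Set.Iio 0) 0 := by
  have : (upToZero fun lam => -extreme lam).NeBot :=
    nhdsWithin_lt_and_neBot countable_not_differentiableAt_neg_extreme 0
  exact tendsto_deriv_upToZero.limUnder_eq

theorem hasDerivWithinAt_extreme_Iio :
    HasDerivWithinAt extreme (derivWithin extreme (Set.Iio 0) 0) (Set.Iio 0) 0 :=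
  convexOn_extreme.hasDerivWithinAt_leftDeriv_of_mem_interior (by simp)

/-- To the left of `0`, `extreme` is at least its value at `0`, so every chord slope there is
nonpositive. -/
theorem leftDeriv_extreme_nonpos : derivWithin extreme (Set.Iio 0) 0 ≤ 0 := by
  refine le_of_tendsto ((hasDerivWithinAt_iff_tendsto_slope' (by simp)).1
    hasDerivWithinAt_extreme_Iio) ?_
  filter_upwards [self_mem_nhdsWithin] with x hx
  have hx : x < 0 := hx
  rw [slope_def_field, sub_zero]
  refine div_nonpos_of_nonneg_of_nonpos ?_ hx.le
  rw [extreme_of_nonneg le_rfl]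
  linarith [le_extreme_of_nonpos hx.le]

end REM

theorem mainTheorem6 (β : ℝ) (hβ : REM.betaC ≤ β) :
    -- the averages are genuine and the infinite-volume free energy exists for every coupling
    (∀ (N : ℕ) (lam : ℝ),
      Integrable (fun E => Real.log (REM.partition2 E β lam)) (REM.disorder N)) ∧
    (∀ lam : ℝ, Tendsto (fun N : ℕ => REM.freeEnergy2N N β lam) atTop
      (𝓝 (REM.freeEnergy2 β lam))) ∧
    -- it is concave, and differentiable off a countable set
    ConcaveOn ℝ Set.univ (REM.freeEnergy2 β) ∧
    {lam : ℝ | ¬ DifferentiableAt ℝ (REM.freeEnergy2 β) lam}.Countable ∧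
    -- the limit of the derivative from the right exists, is the right derivative, and is `-1`
    Tendsto (deriv (REM.freeEnergy2 β)) (REM.downToZero (REM.freeEnergy2 β))
      (𝓝 (REM.derivLimDown (REM.freeEnergy2 β))) ∧
    HasDerivWithinAt (REM.freeEnergy2 β) (REM.derivLimDown (REM.freeEnergy2 β)) (Set.Ioi 0) 0 ∧
    -REM.derivLimDown (REM.freeEnergy2 β) = 1 ∧
    -- the limit of the derivative from the left exists, is the left derivative, and is bounded
    Tendsto (deriv (REM.freeEnergy2 β)) (REM.upToZero (REM.freeEnergy2 β))
      (𝓝 (REM.derivLimUp (REM.freeEnergy2 β))) ∧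
    HasDerivWithinAt (REM.freeEnergy2 β) (REM.derivLimUp (REM.freeEnergy2 β)) (Set.Iio 0) 0 ∧
    -REM.derivLimUp (REM.freeEnergy2 β) ≤ 1 - REM.betaC / β ∧
    -- non-differentiability and the jump
    ¬ DifferentiableAt ℝ (REM.freeEnergy2 β) 0 ∧
    0 < REM.qJump β := by

  have hs := REM.four_fifths_lt_sqrt_log_two
  have hc : 0 < REM.betaC := by unfold REM.betaC; linarith
  have hβ0 : 0 < β := hc.trans_le hβ
  have hle := REM.leftDeriv_extreme_nonpos
  have hf := REM.freeEnergy2_eq hβ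
  refine ⟨fun N lam => REM.integrable_log_partition2 N β lam, ?_, ?_⟩
  · intro lam
    rw [hf]
    exact REM.tendsto_freeEnergy2N hβ lam
  rw [REM.qJump, hf, REM.derivLimDown_neg_extreme, REM.derivLimUp_neg_extreme]
  have hleft : HasDerivWithinAt (fun lam => -REM.extreme lam)
      (-derivWithin REM.extreme (Set.Iio 0) 0) (Set.Iio 0) 0 :=
    REM.hasDerivWithinAt_extreme_Iio.neg
  refine ⟨REM.convexOn_extreme.neg, REM.countable_not_differentiableAt_neg_extreme,
    REM.tendsto_deriv_downToZero, REM.hasDerivWithinAt_neg_extreme_zero, by norm_num,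
    REM.tendsto_deriv_upToZero, hleft, ?_, ?_, by linarith⟩
  -- The left quantity is already at most `0`, and `betaC ≤ β` makes the claimed bound nonnegative.
  · have : REM.betaC / β ≤ 1 := (div_le_one hβ0).2 hβ
    linarith
  · intro hd
    have e1 := (uniqueDiffWithinAt_Ioi 0).eq_deriv _ hd.hasDerivAt.hasDerivWithinAt REM.hasDerivWithinAt_neg_extreme_zero
    have e2 := (uniqueDiffWithinAt_Iio 0).eq_deriv _ hd.hasDerivAt.hasDerivWithinAt hleft
    linarith
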